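/- There is a deterministic algorithm that takes as input positive integers $D<N$ with $D>\exp\left(\sqrt{2\log N\log\log N}\right)$, runs in time $O(D^{1/2+o(1)})$ (bit complexity, that is, logarithmic cost, on a random access machine; $o(1)$ denotes a function of $D$ alone that tends to $0$ as $D\to\infty$, and the implied constant is absolute), and returns one of the following three things, which is correct for the input: - an element $a\in\mathbb{Z}_N^*$ whose multiplicative order $\operatorname{ord}_N(a)$ modulo $N$, the smallest positive integer $k$ with $a^k\equiv 1\pmod N$, satisfies $\operatorname{ord}_N(a)>D$; - a nontrivial factor of $N$, that is, a divisor $d$ of $N$ with $1<d<N$; - the message "$N$ is prime", and then $N$ is indeed prime. -/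

import Mathlib

/-! A deterministic random access machine with logarithmic (bit) cost.

The machine has registers and a random access memory, both holding natural numbers of unbounded
size. Every elementary instruction is charged in terms of the bit lengths of all the numbers
that it handles, memory addresses included; multiplication and division are charged the product
of the bit lengths, as for the schoolbook methods. A program is a finite syntactic object, so it
names finitely many registers and constants and is the same for all inputs. -/

namespace RAM

/-- The bit length of `x`, with `0` counted as having one digit. -/
def len (x : ℕ) : ℕ := max 1 (Nat.size x)

/-- The arithmetic instructions. -/
inductive Op where
  | add | sub | mul | div | mod

/-- The result of an arithmetic instruction on natural numbers: subtraction is truncated at `0`,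
`div` and `mod` are quotient and remainder, with `x / 0 = 0` and `x % 0 = x`. -/
def Op.eval : Op → ℕ → ℕ → ℕ
  | .add, x, y => x + y
  | .sub, x, y => x - y
  | .mul, x, y => x * y
  | .div, x, y => x / y
  | .mod, x, y => x % y

/-- The bit cost of an arithmetic instruction. -/
def Op.cost : Op → ℕ → ℕ → ℕ
  | .add, x, y => len x + len y
  | .sub, x, y => len x + len y
  | .mul, x, y => len x * len y
  | .div, x, y => len x * len y
  | .mod, x, y => len x * len y

/-- Programs. The arguments of type `ℕ` are register numbers, except for the constant `c`. -/
inductive Prog where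
  /-- do nothing -/
  | skip
  /-- `reg r := c` -/
  | const (r c : ℕ)
  /-- `reg r := reg x o reg y` -/
  | arith (o : Op) (r x y : ℕ)
  /-- `reg r := mem (reg a)` -/
  | load (r a : ℕ)
  /-- `mem (reg a) := reg x` -/
  | store (a x : ℕ)
  /-- first `p`, then `q` -/
  | seq (p q : Prog)
  /-- if `reg x ≠ 0` then `p` else `q` -/
  | cond (x : ℕ) (p q : Prog)
  /-- while `reg x ≠ 0` do `p` -/
  | loop (x : ℕ) (p : Prog)

/-- The contents of the registers and of the memory. -/
structure State where
  reg : ℕ → ℕ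
  mem : ℕ → ℕ

/-- Assign the value `v` to register `r`. -/
def State.setReg (s : State) (r v : ℕ) : State := ⟨Function.update s.reg r v, s.mem⟩

/-- Write the value `v` to memory address `a`. -/
def State.setMem (s : State) (a v : ℕ) : State := ⟨s.reg, Function.update s.mem a v⟩

/-- `Exec p s t s'`: started in state `s`, the program `p` halts in state `s'` and its running
time (the total cost of all instructions and tests performed) is `t`. -/
inductive Exec : Prog → State → ℕ → State → Prop where
  | skip (s : State) : Exec .skip s 1 s
  | const (r c : ℕ) (s : State) : Exec (.const r c) s (len c) (s.setReg r c)
  | arith (o : Op) (r x y : ℕ) (s : State) :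
      Exec (.arith o r x y) s (o.cost (s.reg x) (s.reg y))
        (s.setReg r (o.eval (s.reg x) (s.reg y)))
  | load (r a : ℕ) (s : State) :
      Exec (.load r a) s (len (s.reg a) + len (s.mem (s.reg a)))
        (s.setReg r (s.mem (s.reg a)))
  | store (a x : ℕ) (s : State) :
      Exec (.store a x) s (len (s.reg a) + len (s.reg x)) (s.setMem (s.reg a) (s.reg x))
  | seq {p q : Prog} {s s' s'' : State} {t t' : ℕ} :
      Exec p s t s' → Exec q s' t' s'' → Exec (.seq p q) s (t + t') s''
  | cond_true {x : ℕ} {p q : Prog} {s s' : State} {t : ℕ} :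
      s.reg x ≠ 0 → Exec p s t s' → Exec (.cond x p q) s (len (s.reg x) + t) s'
  | cond_false {x : ℕ} {p q : Prog} {s s' : State} {t : ℕ} :
      s.reg x = 0 → Exec q s t s' → Exec (.cond x p q) s (len (s.reg x) + t) s'
  | loop_stop {x : ℕ} {p : Prog} {s : State} :
      s.reg x = 0 → Exec (.loop x p) s (len (s.reg x)) s
  | loop_step {x : ℕ} {p : Prog} {s s' s'' : State} {t t' : ℕ} :
      s.reg x ≠ 0 → Exec p s t s' → Exec (.loop x p) s' t' s'' →
      Exec (.loop x p) s (len (s.reg x) + t + t') s''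

/-- Execution is deterministic: the program and the initial state determine the running time and
the final state. -/
theorem Exec.deterministic {p : Prog} {s s₁ s₂ : State} {t₁ t₂ : ℕ}
    (h₁ : Exec p s t₁ s₁) (h₂ : Exec p s t₂ s₂) : t₁ = t₂ ∧ s₁ = s₂ := by
  induction h₁ generalizing t₂ s₂ with
  | skip s => cases h₂; exact ⟨rfl, rfl⟩
  | const r c s => cases h₂; exact ⟨rfl, rfl⟩
  | arith o r x y s => cases h₂; exact ⟨rfl, rfl⟩
  | load r a s => cases h₂; exact ⟨rfl, rfl⟩
  | store a x s => cases h₂; exact ⟨rfl, rfl⟩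
  | seq _ _ ih ih' =>
    cases h₂ with
    | seq k k' =>
      obtain ⟨rfl, rfl⟩ := ih k
      obtain ⟨rfl, rfl⟩ := ih' k'
      exact ⟨rfl, rfl⟩
  | cond_true hx _ ih =>
    cases h₂ with
    | cond_true _ k => obtain ⟨rfl, rfl⟩ := ih k; exact ⟨rfl, rfl⟩
    | cond_false hx' _ => exact absurd hx' hx
  | cond_false hx _ ih =>
    cases h₂ with
    | cond_true hx' _ => exact absurd hx hx'
    | cond_false _ k => obtain ⟨rfl, rfl⟩ := ih k; exact ⟨rfl, rfl⟩
  | loop_stop hx =>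
    cases h₂ with
    | loop_stop _ => exact ⟨rfl, rfl⟩
    | loop_step hx' _ _ => exact absurd hx hx'
  | loop_step hx _ _ ih ih' =>
    cases h₂ with
    | loop_stop hx' => exact absurd hx' hx
    | loop_step _ k k' =>
      obtain ⟨rfl, rfl⟩ := ih k
      obtain ⟨rfl, rfl⟩ := ih' k'
      exact ⟨rfl, rfl⟩

/-- The initial state on input `(N, D)`: the input is in registers `0` and `1`, all other
registers and the whole memory are `0`. -/
def init (N D : ℕ) : State :=
  ⟨fun i => if i = 0 then N else if i = 1 then D else 0, fun _ => 0⟩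

end RAM

/-- The three kinds of answers: an element of large order, a nontrivial factor, and the message
that the input is prime. -/
inductive Answer where
  | element (a : ℕ)
  | factor (d : ℕ)
  | prime

/-- When an answer is correct for `(N, D)`. Elements of `ℤ/N` are given by their representative
in `{0, …, N - 1}`. -/
def Answer.Correct (N D : ℕ) : Answer → Prop
  | .element a => ∃ u : (ZMod N)ˣ, (u : ZMod N).val = a ∧ D < orderOf u
  | .factor d => d ∣ N ∧ 1 < d ∧ d < N
  | .prime => N.Prime

/-- A halted machine returns its answer as a tag in register `0` and a value in register `1`. -/
def Answer.ReturnedIn (s : RAM.State) : Answer → Prop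
  | .element a => s.reg 0 = 0 ∧ s.reg 1 = a
  | .factor d => s.reg 0 = 1 ∧ s.reg 1 = d
  | .prime => s.reg 0 = 2

/-! Let `B = ⌊√(4 * D)⌋ + 1`, so that `B ^ 2 > 4 * D`. Trial division up to `B + 1` either finds a
factor, or shows that `N ≤ B ^ 2` is prime, or leaves an `N > B ^ 2` that is prime to all numbers
up to `B`. In the last case the algorithm keeps a number `M ≤ D` and an element `g` that has order
`M` modulo every prime factor of `N`, and goes through the numbers `a = B, …, 1`.

If `c = a ^ M` is not `1` modulo `N`, its order `n` is computed with baby steps and giant steps,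
where the random access memory is addressed by the residues themselves. If there is no `n ≤ B ^ 2`,
then `c` is the answer. Otherwise let `q` be the least prime factor of `n` and `k = n / q`. Either
`c ^ k - 1` has a factor in common with `N`, or `c ^ k ≠ 1` modulo every prime factor of `N`, and
then `M` can be replaced by `M * q` (`orderOf_mul_pow_eq`). If now `M > D`, then `g` is the answer.
There are at most `log₂ D + 1` such enlargements, each taking about `B` modular powers.

In the end all numbers up to `B` satisfy `x ^ M = 1` modulo every prime factor `p` of `N`, so the
reduced fractions with numerator and denominator up to `B` do, too. There are at least `B ^ 2 / 4`
of them (`sq_le_four_mul_card_coprime`), more than `D ≥ M`, and they would be distinct modulo `p`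
if `p > B ^ 2`; a field does not have so many roots of unity of order `M`. Hence `p ≤ B ^ 2`. As
`1, …, B` are distinct roots of unity, `M ≥ B`, so `p = i * M + 1` with `i ≤ B`
(`exists_eq_mul_add_one`). The least divisor of `N` of this form is a proper factor, or `N` itself,
which is prime in this case.

This takes `O(B * L ^ 2)` steps on numbers of `L = O(log N)` bits, and the lower bound for `D`
gives `log N ≤ (log D) ^ 2 + 2` (`log_le_sq_log`). So the bit cost is at most
`√D * (log D + 2) ^ 8` up to a constant factor.

Programs are verified by `vc`, a weakest-precondition calculus with a step clock
(`vc_sound`, `vc_loop`). Subroutines use the registers from `20` (`order`), `30` (`leastDivisor`,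
`euclid`) or `40` (`modpow`) on, so that lower registers survive a call. Throughout, register `0`
holds `N`, `1` holds `D`, `2` holds `B`, `4` holds `M`, `5` holds `g`, `6` holds `a`; `7` is set
when an answer with tag in `8` and value in `9` has been found. -/

namespace RAM

/-! ### Verification conditions with a step clock -/

/-- All registers and memory cells hold numbers of at most `L` bits. -/
def Bdd (L : ℕ) (s : State) : Prop := (∀ r, s.reg r < 2 ^ L) ∧ ∀ a, s.mem a < 2 ^ L

/-- A sufficient condition for the result of an instruction on `L`-bit numbers to have at most
`L` bits. Subtraction, division and remainder never exceed their first argument; adding to `0`, as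
in copying a register, needs no bound either. -/
def Op.Fits (L : ℕ) : Op → ℕ → ℕ → Prop
  | .add, x, y => x = 0 ∨ x + y < 2 ^ L
  | .mul, x, y => x * y < 2 ^ L
  | _, _, _ => True

/-- `vc L p Q s τ` says that the program `p`, started in the state `s` when the clock shows `τ`,
halts in a state `s'` at a time `τ'` with `Q s' τ'`, and that all numbers keep to `L` bits on the
way. The clock counts instructions and tests, not bits. For a loop the condition is stated
semantically; otherwise it unfolds along the program. -/
def vc (L : ℕ) : Prog → (State → ℕ → Prop) → State → ℕ → Prop
  | .skip, Q, s, τ => Q s (τ + 1)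
  | .const r c, Q, s, τ => c < 2 ^ L ∧ Q (s.setReg r c) (τ + 1)
  | .arith o r x y, Q, s, τ =>
      o.Fits L (s.reg x) (s.reg y) ∧ Q (s.setReg r (o.eval (s.reg x) (s.reg y))) (τ + 1)
  | .load r a, Q, s, τ => Q (s.setReg r (s.mem (s.reg a))) (τ + 1)
  | .store a x, Q, s, τ => Q (s.setMem (s.reg a) (s.reg x)) (τ + 1)
  | .seq p q, Q, s, τ => vc L p (vc L q Q) s τ
  | .cond x p q, Q, s, τ =>
      (s.reg x ≠ 0 → vc L p Q s (τ + 1)) ∧ (s.reg x = 0 → vc L q Q s (τ + 1))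
  | .loop x p, Q, s, τ => Bdd L s → ∃ t s' k, Exec (.loop x p) s t s' ∧
      t ≤ k * (2 * L ^ 2) ∧ Bdd L s' ∧ Q s' (τ + k)

theorem len_le {L x : ℕ} (hL : 1 ≤ L) (h : x < 2 ^ L) : len x ≤ L :=
  max_le hL (Nat.size_le.2 h)

theorem Op.cost_le {L x y : ℕ} (o : Op) (hL : 1 ≤ L) (hx : x < 2 ^ L) (hy : y < 2 ^ L) :
    o.cost x y ≤ 1 * (2 * L ^ 2) := by
  have h1 := len_le hL hx
  have h2 := len_le hL hy
  have h3 : len x * len y ≤ L * L := Nat.mul_le_mul h1 h2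
  cases o <;> simp only [Op.cost] <;> nlinarith

theorem Op.eval_lt {L x y : ℕ} (o : Op) (h : o.Fits L x y) (hx : x < 2 ^ L) (hy : y < 2 ^ L) :
    o.eval x y < 2 ^ L := by
  cases o with
  | add =>
    rcases h with h | h
    · simpa [Op.eval, h] using hy
    · exact h
  | sub => exact (Nat.sub_le _ _).trans_lt hx
  | mul => exact h
  | div => exact (Nat.div_le_self _ _).trans_lt hx
  | mod => exact (Nat.mod_le _ _).trans_lt hx

theorem Bdd.setReg {L : ℕ} {s : State} (h : Bdd L s) (r : ℕ) {v : ℕ} (hv : v < 2 ^ L) :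
    Bdd L (s.setReg r v) := by
  refine ⟨fun r' => ?_, h.2⟩
  by_cases hr : r' = r
  · simpa [State.setReg, hr] using hv
  · simpa [State.setReg, hr] using h.1 r'

theorem Bdd.setMem {L : ℕ} {s : State} (h : Bdd L s) (a : ℕ) {v : ℕ} (hv : v < 2 ^ L) :
    Bdd L (s.setMem a v) := by
  refine ⟨h.1, fun a' => ?_⟩
  by_cases hr : a' = a
  · simpa [State.setMem, hr] using hv
  · simpa [State.setMem, hr] using h.2 a'

/-- A verification condition yields a halting execution in which a step costs at most `2 * L ^ 2`
bit operations. -/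
theorem vc_sound {L : ℕ} (hL : 1 ≤ L) (p : Prog) : ∀ {Q : State → ℕ → Prop} {s : State} {τ : ℕ},
    vc L p Q s τ → Bdd L s → ∃ t s' k, Exec p s t s' ∧ t ≤ k * (2 * L ^ 2) ∧ Bdd L s' ∧
      Q s' (τ + k) := by
  have hLL : L ≤ L ^ 2 := by nlinarith
  induction p with
  | skip => intro Q s τ h hb; exact ⟨_, _, 1, .skip s, by nlinarith, hb, h⟩
  | const r c =>
    intro Q s τ h hb
    exact ⟨_, _, 1, .const r c s, by have := len_le hL h.1; omega, hb.setReg r h.1, h.2⟩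
  | arith o r x y =>
    intro Q s τ h hb
    exact ⟨_, _, 1, .arith o r x y s, o.cost_le hL (hb.1 _) (hb.1 _),
      hb.setReg r (o.eval_lt h.1 (hb.1 _) (hb.1 _)), h.2⟩
  | load r a =>
    intro Q s τ h hb
    refine ⟨_, _, 1, .load r a s, ?_, hb.setReg r (hb.2 _), h⟩
    have h1 := len_le hL (hb.1 a)
    have h2 := len_le hL (hb.2 (s.reg a))
    omega
  | store a x =>
    intro Q s τ h hb
    refine ⟨_, _, 1, .store a x s, ?_, hb.setMem _ (hb.1 _), h⟩
    have h1 := len_le hL (hb.1 a)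
    have h2 := len_le hL (hb.1 x)
    omega
  | seq p q ihp ihq =>
    intro Q s τ h hb
    obtain ⟨t, s', k, he, ht, hb', h'⟩ := ihp h hb
    obtain ⟨t', s'', k', he', ht', hb'', h''⟩ := ihq h' hb'
    exact ⟨_, _, k + k', .seq he he', by rw [add_mul]; omega, hb'', by rwa [← add_assoc]⟩
  | cond x p q ihp ihq =>
    intro Q s τ h hb
    have h1 := len_le hL (hb.1 x)
    by_cases hx : s.reg x = 0
    · obtain ⟨t, s', k, he, ht, hb', h'⟩ := ihq (h.2 hx) hb
      exact ⟨_, _, 1 + k, .cond_false hx he, by rw [add_mul]; omega, hb',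
        by rwa [← add_assoc]⟩
    · obtain ⟨t, s', k, he, ht, hb', h'⟩ := ihp (h.1 hx) hb
      exact ⟨_, _, 1 + k, .cond_true hx he, by rw [add_mul]; omega, hb',
        by rwa [← add_assoc]⟩
  | loop x p ih => intro Q s τ h hb; exact h hb

theorem vc_mono {L : ℕ} {p : Prog} : ∀ {Q Q' : State → ℕ → Prop} {s : State} {τ : ℕ},
    (∀ s τ, Q s τ → Q' s τ) → vc L p Q s τ → vc L p Q' s τ := by
  induction p with
  | skip => intro Q Q' s τ h hp; exact h _ _ hp
  | const r c => intro Q Q' s τ h hp; exact ⟨hp.1, h _ _ hp.2⟩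
  | arith o r x y => intro Q Q' s τ h hp; exact ⟨hp.1, h _ _ hp.2⟩
  | load r a => intro Q Q' s τ h hp; exact h _ _ hp
  | store a x => intro Q Q' s τ h hp; exact h _ _ hp
  | seq p q ihp ihq => intro Q Q' s τ h hp; exact ihp (fun _ _ => ihq h) hp
  | cond x p q ihp ihq =>
    intro Q Q' s τ h hp
    exact ⟨fun hx => ihp h (hp.1 hx), fun hx => ihq h (hp.2 hx)⟩
  | loop x p ih =>
    intro Q Q' s τ h hp hb
    obtain ⟨t, s', k, he, ht, hb', hq⟩ := hp hb
    exact ⟨t, s', k, he, ht, hb', h _ _ hq⟩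

/-- The loop rule. The invariant `I s b` includes a budget `b` for the remaining number of steps;
every round has to pay for its own steps, and this also forces termination. -/
theorem vc_loop {L : ℕ} (hL : 1 ≤ L) {x : ℕ} {p : Prog} {Q : State → ℕ → Prop} {s : State}
    {τ : ℕ} (I : State → ℕ → Prop) {b : ℕ} (h₀ : I s b)
    (hbody : ∀ s b, I s b → s.reg x ≠ 0 →
      vc L p (fun s' k => ∃ b', I s' b' ∧ k + b' ≤ b) s 1)
    (hend : ∀ s b' τ', I s b' → s.reg x = 0 → τ' ≤ τ + b + 1 → Q s τ') :
    vc L (.loop x p) Q s τ := by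
  have key : ∀ b s, I s b → Bdd L s → ∃ t s' k b', Exec (.loop x p) s t s' ∧
      t ≤ k * (2 * L ^ 2) ∧ Bdd L s' ∧ I s' b' ∧ s'.reg x = 0 ∧ k ≤ b + 1 := by
    have hLL : L ≤ L ^ 2 := by nlinarith
    intro b
    induction b using Nat.strong_induction_on with
    | _ b ih =>
      intro s hI hb
      have h1 := len_le hL (hb.1 x)
      by_cases hx : s.reg x = 0
      · exact ⟨len (s.reg x), s, 1, b, by constructor; exact hx, by omega, hb, hI, hx, by omega⟩
      · obtain ⟨t, s', k, he, ht, hb', b', hI', hk⟩ := vc_sound hL p (hbody s b hI hx) hb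
        obtain ⟨t', s'', k', b'', he', ht', hb'', hI'', hx'', hk'⟩ :=
          ih b' (by omega) s' hI' hb'
        exact ⟨_, _, 1 + k + k', b'', .loop_step hx he he', by rw [add_mul, add_mul]; omega,
          hb'', hI'', hx'', by omega⟩
  intro hb
  obtain ⟨t, s', k, b', he, ht, hb', hI, hx, hk⟩ := key b s h₀ hb
  exact ⟨t, s', k, he, ht, hb', hend s' b' _ hI hx (by omega)⟩

/-- The loop rule for a loop controlled by a counter that decreases by one in each round. -/
theorem vc_loop_counter {L : ℕ} (hL : 1 ≤ L) {x : ℕ} {p : Prog} {Q : State → ℕ → Prop}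
    {s : State} {τ : ℕ} (J : ℕ → State → Prop) (c k : ℕ) (h₀ : J k s)
    (hx : ∀ k s, J k s → s.reg x = k)
    (hbody : ∀ k' s, k' < k → J (k' + 1) s → vc L p (fun s' t => J k' s' ∧ t ≤ c) s 1)
    (hend : ∀ s τ', J 0 s → τ' ≤ τ + k * c + 1 → Q s τ') :
    vc L (.loop x p) Q s τ := by
  refine vc_loop hL (fun s b => ∃ k', k' ≤ k ∧ J k' s ∧ b = k' * c) ⟨k, le_rfl, h₀, rfl⟩ ?_ ?_
  · rintro s _ ⟨k', hk', hJ, rfl⟩ h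
    rw [hx _ _ hJ] at h
    obtain ⟨m, rfl⟩ := Nat.exists_eq_succ_of_ne_zero h
    have := hbody m s (by omega) hJ
    refine vc_mono ?_ this
    rintro s' t ⟨h1, h2⟩
    exact ⟨_, ⟨m, by omega, h1, rfl⟩, by rw [Nat.succ_mul]; omega⟩
  · rintro s _ τ' ⟨k', hk', hJ, rfl⟩ h hτ
    rw [hx _ _ hJ] at h
    subst h
    exact hend _ _ hJ hτ
end RAM

namespace RAM

/-! ### Straight-line code, modular powers, greatest common divisors -/

@[simp] theorem reg_setReg (s : State) (r v i : ℕ) :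
    (s.setReg r v).reg i = if i = r then v else s.reg i := by
  simp [State.setReg, Function.update_apply]

@[simp] theorem mem_setReg (s : State) (r v : ℕ) : (s.setReg r v).mem = s.mem := rfl

@[simp] theorem reg_setMem (s : State) (a v : ℕ) : (s.setMem a v).reg = s.reg := rfl

@[simp] theorem mem_setMem (s : State) (a v i : ℕ) :
    (s.setMem a v).mem i = if i = a then v else s.mem i := by
  simp [State.setMem, Function.update_apply]

/-- Execute a list of programs one after the other. -/
def block : List Prog → Prog
  | [] => .skip
  | p :: ps => .seq p (block ps)

/-- `reg r := reg x`, for `r ≠ x`. -/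
def mov (r x : ℕ) : Prog := .seq (.const r 0) (.arith .add r r x)

section

variable {L : ℕ} {Q : State → ℕ → Prop} {s : State} {τ : ℕ}

theorem vc_skip : vc L .skip Q s τ ↔ Q s (τ + 1) := Iff.rfl

theorem vc_const {r c : ℕ} :
    vc L (.const r c) Q s τ ↔ c < 2 ^ L ∧ Q (s.setReg r c) (τ + 1) := Iff.rfl

theorem vc_arith {o : Op} {r x y : ℕ} : vc L (.arith o r x y) Q s τ ↔
    o.Fits L (s.reg x) (s.reg y) ∧ Q (s.setReg r (o.eval (s.reg x) (s.reg y))) (τ + 1) := Iff.rfl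

theorem vc_load {r a : ℕ} :
    vc L (.load r a) Q s τ ↔ Q (s.setReg r (s.mem (s.reg a))) (τ + 1) := Iff.rfl

theorem vc_store {a x : ℕ} :
    vc L (.store a x) Q s τ ↔ Q (s.setMem (s.reg a) (s.reg x)) (τ + 1) := Iff.rfl

theorem vc_cond {x : ℕ} {p q : Prog} : vc L (.cond x p q) Q s τ ↔
    (s.reg x ≠ 0 → vc L p Q s (τ + 1)) ∧ (s.reg x = 0 → vc L q Q s (τ + 1)) := Iff.rfl

theorem vc_block_nil : vc L (block []) Q s τ ↔ Q s (τ + 1) := Iff.rfl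

theorem vc_block_cons {p : Prog} {ps : List Prog} :
    vc L (block (p :: ps)) Q s τ ↔ vc L p (vc L (block ps) Q) s τ := Iff.rfl

theorem vc_mov {r x : ℕ} :
    vc L (mov r x) Q s τ ↔ Q (s.setReg r (if x = r then 0 else s.reg x)) (τ + 2) := by
  have : (s.setReg r 0).setReg r (if x = r then 0 else s.reg x) =
      s.setReg r (if x = r then 0 else s.reg x) := by simp [State.setReg]
  simp [mov, vc, Op.Fits, Op.eval, this, add_assoc]

end

/-- `reg 42 := reg 40 ^ reg 41 % reg 0` by repeated squaring. Only registers from `40` on are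
used. -/
def modpow : Prog := block [.const 42 1, .const 43 2, .loop 41 (block [
  .arith .mod 44 41 43,
  .cond 44 (block [.arith .mul 42 42 40, .arith .mod 42 42 0]) .skip,
  .arith .mul 40 40 40, .arith .mod 40 40 0, .arith .div 41 41 43])]

theorem vc_modpow {L N τ : ℕ} {Q : State → ℕ → Prop} {s : State} (hL : 1 < L) (hN : 1 < N)
    (hNL : N * N ≤ 2 ^ L) (h0 : s.reg 0 = N) (hx : s.reg 40 < N) (he : s.reg 41 < 2 ^ L)
    (hQ : ∀ s' τ', s'.reg 42 = s.reg 40 ^ s.reg 41 % N → (∀ r < 40, s'.reg r = s.reg r) →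
      s'.mem = s.mem → τ' ≤ τ + 20 * L → Q s' τ') : vc L modpow Q s τ := by
  have h4 : 4 ≤ 2 ^ L := (Nat.pow_le_pow_right (n := 2) (by norm_num) hL :)
  simp only [modpow, vc_block_cons, vc_const]
  refine ⟨by omega, by omega, vc_loop (by omega) (b := 10 * L) (fun s' b => ∃ m, b = 10 * m ∧
      s'.reg 41 < 2 ^ m ∧ s'.reg 40 < N ∧ s'.reg 42 < N ∧ s'.reg 43 = 2 ∧
      (s'.reg 42 * s'.reg 40 ^ s'.reg 41) % N = s.reg 40 ^ s.reg 41 % N ∧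
      (∀ r < 40, s'.reg r = s.reg r) ∧ s'.mem = s.mem) ?_ ?_ ?_⟩
  · refine ⟨L, rfl, ?_⟩
    simp only [reg_setReg, mem_setReg]
    norm_num
    refine ⟨he, hx, hN, ?_⟩
    intro r hr
    rw [if_neg (by omega), if_neg (by omega)]
  · rintro s' _ ⟨m, rfl, he', hx', hy', h2, hinv, hfr, hm⟩ hne
    obtain ⟨m, rfl⟩ : ∃ k, m = k + 1 := by
      rcases m with _ | k
      · simp at he'; omega
      · exact ⟨k, rfl⟩
    have hN0 : s'.reg 0 = N := by rw [hfr 0 (by norm_num), h0]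
    have hlt : ∀ a < N, ∀ b < N, a * b < 2 ^ L := fun a ha b hb =>
      (Nat.mul_lt_mul'' ha hb).trans_le hNL
    have hdiv : s'.reg 41 / 2 < 2 ^ m := by
      rw [Nat.div_lt_iff_lt_mul (by norm_num)]; rwa [pow_succ] at he'
    have hmod := Nat.mod_lt (s'.reg 41) (show 0 < 2 by norm_num)
    have hdm := Nat.div_add_mod (s'.reg 41) 2
    simp only [vc_skip, vc_arith, vc_cond, vc_block_nil, vc_block_cons, Op.Fits, Op.eval, reg_setReg, mem_setReg]
    norm_num
    simp only [h2, hN0, true_and]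
    have hpos : 0 < N := by omega
    constructor
    · intro hodd
      refine ⟨hlt _ hy' _ hx', hlt _ hx' _ hx', _, ⟨m, rfl, hdiv, Nat.mod_lt _ hpos,
        Nat.mod_lt _ hpos, ?_, ?_, hm⟩, by omega⟩
      · rw [← hinv]
        have h1 : s'.reg 41 = 2 * (s'.reg 41 / 2) + 1 := by omega
        conv_rhs => rw [h1, pow_succ, pow_mul]
        rw [← Nat.mod_mul_mod, Nat.mul_mod, Nat.pow_mod]
        simp only [Nat.mod_mod]
        rw [← Nat.pow_mod, ← Nat.mul_mod]
        congr 1; ring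
      · intro r hr
        simp only [show r ≠ 41 by omega, show r ≠ 40 by omega, show r ≠ 42 by omega,
          show r ≠ 44 by omega, if_false, hfr r hr]
    · intro heven
      refine ⟨hlt _ hx' _ hx', _, ⟨m, rfl, hdiv, Nat.mod_lt _ hpos, hy', ?_, ?_, hm⟩, by omega⟩
      · rw [← hinv]
        have h1 : s'.reg 41 = 2 * (s'.reg 41 / 2) := by omega
        conv_rhs => rw [h1, pow_mul]
        rw [Nat.mul_mod, Nat.pow_mod]
        simp only [Nat.mod_mod]
        rw [← Nat.pow_mod, ← Nat.mul_mod]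
        congr 2; ring
      · intro r hr
        simp only [show r ≠ 41 by omega, show r ≠ 40 by omega, show r ≠ 44 by omega, if_false,
          hfr r hr]
  · rintro s' _ τ' ⟨m, rfl, he', hx', hy', h2, hinv, hfr, hm⟩ hz hτ
    rw [hz, pow_zero, mul_one, Nat.mod_eq_of_lt hy'] at hinv
    simp only [vc_block_nil]
    exact hQ _ _ hinv hfr hm (by omega)

/-- `reg 30 := gcd (reg 30) (reg 31)` by Euclid's algorithm, for `reg 31 ≤ reg 30`. -/
def euclid : Prog := block [.loop 31 (block [.arith .mod 32 30 31, mov 30 31, mov 31 32])]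

/-- The product of the two numbers is at least halved in each round. -/
theorem vc_euclid {L m τ : ℕ} {Q : State → ℕ → Prop} {s : State} (hL : 1 ≤ L)
    (hle : s.reg 31 ≤ s.reg 30) (hm : s.reg 30 * s.reg 31 < 2 ^ m)
    (hQ : ∀ s' τ', s'.reg 30 = (s.reg 30).gcd (s.reg 31) → (∀ r < 30, s'.reg r = s.reg r) →
      s'.mem = s.mem → τ' ≤ τ + 10 * m + 2 → Q s' τ') : vc L euclid Q s τ := by
  simp only [euclid, vc_block_cons]
  refine vc_loop hL (b := 10 * m) (fun s' b => ∃ m, b = 10 * m ∧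
      s'.reg 30 * s'.reg 31 < 2 ^ m ∧ s'.reg 31 ≤ s'.reg 30 ∧
      (s'.reg 30).gcd (s'.reg 31) = (s.reg 30).gcd (s.reg 31) ∧
      (∀ r < 30, s'.reg r = s.reg r) ∧ s'.mem = s.mem)
      ⟨m, rfl, hm, hle, rfl, fun _ _ => rfl, rfl⟩ ?_ ?_
  · rintro s' _ ⟨m, rfl, hm, hle, hg, hfr, hmem⟩ hne
    have hpos : 0 < s'.reg 31 := Nat.pos_of_ne_zero hne
    have hml := Nat.mod_lt (s'.reg 30) hpos
    have hdm := Nat.div_add_mod (s'.reg 30) (s'.reg 31)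
    have hd : 1 ≤ s'.reg 30 / s'.reg 31 := (Nat.one_le_div_iff hpos).2 hle
    have h2 : 2 * (s'.reg 30 % s'.reg 31) ≤ s'.reg 30 := by
      have := Nat.mul_le_mul_left (s'.reg 31) hd
      omega
    obtain ⟨m, rfl⟩ : ∃ k, m = k + 1 := by
      rcases m with _ | k
      · have := Nat.mul_pos (hpos.trans_le hle) hpos
        omega
      · exact ⟨k, rfl⟩
    have hprod : s'.reg 31 * (s'.reg 30 % s'.reg 31) < 2 ^ m := by
      rw [pow_succ] at hm
      nlinarith
    simp only [vc_arith, vc_block_nil, vc_block_cons, vc_mov, Op.Fits, Op.eval,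
      reg_setReg, mem_setReg]
    norm_num
    refine ⟨_, ⟨m, rfl, hprod, hml.le, ?_, ?_, hmem⟩, by omega⟩
    · rw [← hg, Nat.gcd_comm (s'.reg 30), Nat.gcd_rec (s'.reg 31) (s'.reg 30), Nat.gcd_comm]
    · intro r hr
      simp only [show r ≠ 30 by omega, show r ≠ 31 by omega, show r ≠ 32 by omega, if_false,
        hfr r hr]
  · rintro s' _ τ' ⟨m, rfl, hm, hle, hg, hfr, hmem⟩ hz hτ
    rw [hz, Nat.gcd_zero_right] at hg
    exact hQ _ _ hg hfr hmem (by omega)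

/-! ### Least divisors in an arithmetic progression -/

/-- `reg 32` := the least divisor of `reg 30` of the form `i * reg 31 + 1` with
`1 ≤ i ≤ reg 2`, and `reg 30` if there is none. The candidates are tried in decreasing order. -/
def leastDivisor : Prog := block [.const 35 1, mov 32 30, mov 33 2, .loop 33 (block [
  .arith .mul 34 33 31, .arith .add 34 34 35, .arith .mod 36 30 34,
  .cond 36 .skip (mov 32 34), .arith .sub 33 33 35])]

/-- `r` is the least divisor of `n` of the form `i * M + 1` with `k < i ≤ B`, and `n` if there
is none. -/
def IsLeastDivisor (n M B k r : ℕ) : Prop :=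
  (r = n ∧ ∀ i, k < i → i ≤ B → ¬ i * M + 1 ∣ n) ∨
    ∃ i, k < i ∧ i ≤ B ∧ r = i * M + 1 ∧ r ∣ n ∧ ∀ j, k < j → j < i → ¬ j * M + 1 ∣ n

theorem vc_leastDivisor {L M B n τ : ℕ} {Q : State → ℕ → Prop} {s : State} (hL : 1 ≤ L)
    (h2 : s.reg 2 = B) (hn : s.reg 30 = n) (hM : s.reg 31 = M) (hB : B * M + 1 < 2 ^ L)
    (hQ : ∀ s' τ', IsLeastDivisor n M B 0 (s'.reg 32) → (∀ r < 30, s'.reg r = s.reg r) →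
      s'.mem = s.mem → τ' ≤ τ + 10 * B + 10 → Q s' τ') : vc L leastDivisor Q s τ := by
  have h4 : 2 ^ 1 ≤ 2 ^ L := Nat.pow_le_pow_right (by norm_num) hL
  simp only [leastDivisor, vc_block_cons, vc_const, vc_mov]
  refine ⟨by omega, vc_loop_counter hL (fun k s' => s'.reg 33 = k ∧ s'.reg 30 = n ∧ s'.reg 31 = M ∧
      s'.reg 35 = 1 ∧ IsLeastDivisor n M B k (s'.reg 32) ∧ (∀ r < 30, s'.reg r = s.reg r) ∧
      s'.mem = s.mem) 10 B ?_ (fun _ _ h => h.1) ?_ ?_⟩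
  · simp only [reg_setReg, mem_setReg]
    norm_num
    refine ⟨h2, hn, hM, Or.inl ⟨hn, fun i _ _ => by omega⟩, fun r hr => ?_⟩
    simp only [show r ≠ 33 by omega, show r ≠ 35 by omega, show r ≠ 32 by omega, if_false]
  · rintro k s' hk ⟨h33, h30, h31, h35, hld, hfr, hmem⟩
    have hkB : (k + 1) * M ≤ B * M := Nat.mul_le_mul_right _ hk
    simp only [vc_skip, vc_arith, vc_cond, vc_block_nil, vc_block_cons, vc_mov, Op.Fits, Op.eval,
      reg_setReg, mem_setReg]
    norm_num
    simp only [h33, h30, h31, h35, true_and, add_tsub_cancel_right]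
    refine ⟨by omega, by omega, ?_, ?_⟩
    · intro hnd
      refine ⟨?_, fun r hr => ?_, hmem⟩
      · have hnd' : ¬ (k + 1) * M + 1 ∣ n := by rwa [Nat.dvd_iff_mod_eq_zero]
        rcases hld with ⟨h, h'⟩ | ⟨i, hi, hiB, h, hd, hj⟩
        · refine Or.inl ⟨h, fun i hi hiB => ?_⟩
          rcases (Nat.succ_le_of_lt hi).eq_or_lt with h1 | h1
          · rwa [← h1]
          · exact h' i h1 hiB
        · refine Or.inr ⟨i, by omega, hiB, h, hd, fun j hj1 hj2 => ?_⟩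
          rcases (Nat.succ_le_of_lt hj1).eq_or_lt with h1 | h1
          · rwa [← h1]
          · exact hj j h1 hj2
      · simp only [show r ≠ 33 by omega, show r ≠ 34 by omega, show r ≠ 36 by omega, if_false,
          hfr r hr]
    · intro hd
      refine ⟨Or.inr ⟨k + 1, by omega, by omega, rfl, Nat.dvd_of_mod_eq_zero hd,
        fun j h1 h2 => by omega⟩, fun r hr => ?_, hmem⟩
      simp only [show r ≠ 33 by omega, show r ≠ 34 by omega, show r ≠ 36 by omega,
        show r ≠ 32 by omega, if_false, hfr r hr]
  · rintro s' τ' ⟨h33, h30, h31, h35, hld, hfr, hmem⟩ hτ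
    exact hQ _ _ hld hfr hmem (by omega)
end RAM

namespace RAM

/-! ### Orders by baby steps and giant steps -/

theorem pow_giant_eq {N c B k u : ℕ} (hu : u ≤ B) (h : c ^ (k * B + u) % N = 1 % N) :
    c ^ ((k + 1) * B + 1) % N = c ^ (B + 1 - u) % N := by
  have : (k + 1) * B + 1 = (k * B + u) + (B + 1 - u) := by
    rw [add_mul]; omega
  rw [this, pow_add, Nat.mul_mod, h, ← Nat.mul_mod, one_mul]

theorem pow_eq_one_of_giant_eq {N c B k u : ℕ} (hc : c.Coprime N) (hu : u ≤ B)
    (h : c ^ ((k + 1) * B + 1) % N = c ^ (B + 1 - u) % N) : c ^ (k * B + u) % N = 1 % N := by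
  have he : (k + 1) * B + 1 = (B + 1 - u) + (k * B + u) := by
    rw [add_mul]; omega
  have h' : c ^ (B + 1 - u) * c ^ (k * B + u) ≡ c ^ (B + 1 - u) * 1 [MOD N] := by
    rw [← pow_add, ← he, mul_one]; exact h
  exact h'.cancel_left_of_coprime (hc.symm.pow_right _)

/-- For `c = reg 28` and `u = B, …, 1`, where `B = reg 2`, store `u` at the address
`c ^ (B + 1 - u) % N`; a later, smaller `u` overwrites an earlier one. -/
def babySteps : Prog := block [.const 20 1, mov 21 2, .loop 21 (block [
  .arith .sub 23 2 21, .arith .add 23 23 20, mov 40 28, mov 41 23, modpow, .store 42 21,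
  .arith .sub 21 21 20])]

/-- The table of baby steps: the entry for `u` is the least `u'` with the same power. Addresses
that are not powers of `c` may hold entries from earlier tables. -/
def IsTable (N B c k : ℕ) (mem : ℕ → ℕ) : Prop :=
  ∀ u, k < u → u ≤ B → ∃ u', k < u' ∧ u' ≤ u ∧ mem (c ^ (B + 1 - u) % N) = u' ∧
    c ^ (B + 1 - u') % N = c ^ (B + 1 - u) % N

theorem IsTable.step {N B c k : ℕ} {mem : ℕ → ℕ} (h : IsTable N B c (k + 1) mem) :
    IsTable N B c k
      (fun i => if i = c ^ (B + 1 - (k + 1)) % N then k + 1 else mem i) := by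
  intro u hu hB
  by_cases he : c ^ (B + 1 - u) % N = c ^ (B + 1 - (k + 1)) % N
  · exact ⟨k + 1, by omega, by omega, by simp only [he, if_true], he.symm⟩
  · have hne : k + 1 ≠ u := by rintro rfl; exact he rfl
    obtain ⟨u', h1, h2, h3, h4⟩ := h u (by omega) hB
    exact ⟨u', by omega, h2, by simp only [he, if_false, h3], h4⟩

theorem vc_babySteps {L N B c τ : ℕ} {Q : State → ℕ → Prop} {s : State} (hL : 1 < L)
    (hN : 1 < N) (hNL : N * N ≤ 2 ^ L) (hBL : B + 1 < 2 ^ L) (h0 : s.reg 0 = N)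
    (h2 : s.reg 2 = B) (h28 : s.reg 28 = c) (hc : c < N) (hmem : ∀ i, s.mem i ≤ B)
    (hQ : ∀ s' τ', IsTable N B c 0 s'.mem → (∀ i, s'.mem i ≤ B) → s'.reg 28 = c →
      (∀ r < 20, s'.reg r = s.reg r) → τ' ≤ τ + 40 * L * B + 10 → Q s' τ') :
    vc L babySteps Q s τ := by
  simp only [babySteps, vc_block_cons, vc_const, vc_mov]
  refine ⟨by omega, vc_loop_counter (by omega) (fun k s' => s'.reg 21 = k ∧ k ≤ B ∧
    s'.reg 20 = 1 ∧ s'.reg 28 = c ∧ IsTable N B c k s'.mem ∧ (∀ i, s'.mem i ≤ B) ∧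
    (∀ r < 20, s'.reg r = s.reg r)) (40 * L) B ?_ (fun _ _ h => h.1) ?_ ?_⟩
  · simp only [reg_setReg, mem_setReg]
    norm_num
    refine ⟨h2, h28, fun u h1 h2 => by omega, hmem, fun r hr => ?_⟩
    rw [if_neg (by omega), if_neg (by omega)]
  · rintro k s' hk ⟨h21, -, h20, h28, htab, hm, hfr⟩
    have h0' : s'.reg 0 = N := by rw [hfr 0 (by norm_num), h0]
    have h2' : s'.reg 2 = B := by rw [hfr 2 (by norm_num), h2]
    simp only [vc_block_cons, vc_arith, vc_mov, Op.Fits, Op.eval, reg_setReg]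
    norm_num
    simp only [h21, h20, h2']
    refine ⟨by omega, vc_modpow hL hN hNL (by simpa using h0') (by simpa [h28] using hc)
      (by simp; omega) ?_⟩
    intro s₁ τ₁ h42 hfr₁ hm₁ hτ₁
    have e21 : s₁.reg 21 = k + 1 := by rw [hfr₁ 21 (by norm_num)]; simp [h21]
    have e20 : s₁.reg 20 = 1 := by rw [hfr₁ 20 (by norm_num)]; simp [h20]
    have e28 : s₁.reg 28 = c := by rw [hfr₁ 28 (by norm_num)]; simp [h28]
    have e42 : s₁.reg 42 = c ^ (B + 1 - (k + 1)) % N := by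
      rw [h42]; simp only [reg_setReg]; norm_num
      rw [h28]; congr 2; omega
    have emem : s₁.mem = s'.mem := by rw [hm₁]; simp
    simp only [vc_block_nil, vc_block_cons, vc_arith, vc_store, Op.Fits, Op.eval, reg_setReg,
      mem_setReg, mem_setMem, reg_setMem]
    norm_num
    simp only [e21, e20, e28, e42, emem, true_and, add_tsub_cancel_right]
    refine ⟨⟨by omega, ?_, fun i => ?_, fun r hr => ?_⟩, by omega⟩
    · have := htab.step
      intro u h1 h2
      simpa [State.setMem, Function.update_apply, emem] using this u h1 h2
    · split_ifs
      · omega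
      · exact hm i
    · rw [if_neg (by omega), hfr₁ r (by omega)]
      simp only [reg_setReg]
      simp only [show r ≠ 41 by omega, show r ≠ 40 by omega, show r ≠ 23 by omega, if_false,
        hfr r hr]
  · rintro s' τ' ⟨h21, -, h20, h28, htab, hm, hfr⟩ hτ
    exact hQ _ _ htab hm h28 hfr (by rw [mul_comm B] at hτ; omega)

/-- Compare the giant steps `c ^ (j * B + 1)`, for `j = B, …, 1`, with the table. A match with
an entry `u` suggests the period `(j - 1) * B + u`, which is checked because the entry may be
an old one. -/
def giantSteps : Prog := block [.const 20 1, .const 29 0, mov 21 2, .loop 21 (block [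
  .arith .mul 22 21 2, .arith .add 23 22 20, mov 40 28, mov 41 23, modpow, .load 24 42,
  .cond 24 (block [.arith .sub 25 22 2, .arith .add 25 25 24, mov 40 28, mov 41 25, modpow,
    .arith .sub 26 42 20, .cond 26 .skip (mov 29 25)]) .skip,
  .arith .sub 21 21 20])]

/-- `n` is the least exponent in the interval `(k * B, B * B]` with `c ^ n = 1` modulo `N`,
and `0` if there is none. -/
def IsLeastPeriod (N B c k n : ℕ) : Prop :=
  (n = 0 ∨ k * B < n ∧ n ≤ B * B ∧ c ^ n % N = 1) ∧
    ∀ m, k * B < m → m ≤ B * B → c ^ m % N = 1 → 0 < n ∧ n ≤ m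

theorem vc_giantSteps {L N B c τ : ℕ} {Q : State → ℕ → Prop} {s : State} (hL : 1 < L)
    (hN : 1 < N) (hNL : N * N ≤ 2 ^ L) (hBL : B * B + B + 1 < 2 ^ L) (hcop : c.Coprime N)
    (h0 : s.reg 0 = N)
    (h2 : s.reg 2 = B) (h28 : s.reg 28 = c) (hc : c < N) (hmem : ∀ i, s.mem i ≤ B)
    (htab : IsTable N B c 0 s.mem)
    (hQ : ∀ s' τ', IsLeastPeriod N B c 0 (s'.reg 29) → s'.mem = s.mem →
      (∀ r < 20, s'.reg r = s.reg r) → τ' ≤ τ + 80 * L * B + 10 → Q s' τ') :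
    vc L giantSteps Q s τ := by
  simp only [giantSteps, vc_block_cons, vc_const, vc_mov]
  refine ⟨by omega, by omega, vc_loop_counter (by omega) (fun k s' => s'.reg 21 = k ∧ k ≤ B ∧
    s'.reg 20 = 1 ∧ s'.reg 28 = c ∧ IsLeastPeriod N B c k (s'.reg 29) ∧ s'.mem = s.mem ∧
    (∀ r < 20, s'.reg r = s.reg r)) (80 * L) B ?_ (fun _ _ h => h.1) ?_ ?_⟩
  · simp only [reg_setReg, mem_setReg]
    norm_num
    refine ⟨h2, h28, ⟨Or.inl rfl, fun m h1 h2 => by omega⟩, fun r hr => ?_⟩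
    rw [if_neg (by omega), if_neg (by omega), if_neg (by omega)]
  · rintro k s' hk ⟨h21, -, h20, h28, hper, hm, hfr⟩
    have h0' : s'.reg 0 = N := by rw [hfr 0 (by norm_num), h0]
    have h2' : s'.reg 2 = B := by rw [hfr 2 (by norm_num), h2]
    have hkB : (k + 1) * B ≤ B * B := Nat.mul_le_mul_right _ hk
    have hkB' : (k + 1) * B = k * B + B := by ring
    simp only [vc_block_cons, vc_arith, vc_mov, Op.Fits, Op.eval, reg_setReg]
    norm_num
    simp only [h21, h20, h2']
    refine ⟨by omega, by omega, vc_modpow hL hN hNL (by simpa using h0')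
      (by simpa [h28] using hc) (by simp; omega) ?_⟩
    intro s₁ τ₁ h42 hfr₁ hm₁ hτ₁
    have e21 : s₁.reg 21 = k + 1 := by rw [hfr₁ 21 (by norm_num)]; simp [h21]
    have e20 : s₁.reg 20 = 1 := by rw [hfr₁ 20 (by norm_num)]; simp [h20]
    have e28 : s₁.reg 28 = c := by rw [hfr₁ 28 (by norm_num)]; simp [h28]
    have e29 : s₁.reg 29 = s'.reg 29 := by rw [hfr₁ 29 (by norm_num)]; simp
    have e22 : s₁.reg 22 = (k + 1) * B := by rw [hfr₁ 22 (by norm_num)]; simp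
    have e2 : s₁.reg 2 = B := by rw [hfr₁ 2 (by norm_num)]; simp [h2']
    have e0 : s₁.reg 0 = N := by rw [hfr₁ 0 (by norm_num)]; simp [h0']
    have e42 : s₁.reg 42 = c ^ ((k + 1) * B + 1) % N := by
      rw [h42]; simp only [reg_setReg]; norm_num
      rw [h28]
    have emem : s₁.mem = s.mem := by rw [hm₁]; simp [hm]
    have hfr₁' : ∀ r < 20, s₁.reg r = s.reg r := by
      intro r hr
      rw [hfr₁ r (by omega)]
      simp only [reg_setReg]
      simp only [show r ≠ 41 by omega, show r ≠ 40 by omega, show r ≠ 23 by omega,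
        show r ≠ 22 by omega, if_false, hfr r hr]
    simp only [vc_block_nil, vc_block_cons, vc_arith, vc_mov, vc_load, vc_cond, vc_skip, Op.Fits,
      Op.eval, reg_setReg, mem_setReg]
    norm_num
    simp only [e21, e20, e28, e29, e22, e2, e42, emem, true_and, add_tsub_cancel_right, hkB']
    -- every period in the current block is found through the table
    have hfind : ∀ m, k * B < m → m ≤ (k + 1) * B → c ^ m % N = 1 →
        ∃ u, 0 < u ∧ u ≤ B ∧ s.mem (c ^ ((k + 1) * B + 1) % N) = u ∧ k * B + u ≤ m ∧
          c ^ (k * B + u) % N = 1 := by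
      intro m h1 h2 h3
      obtain ⟨u, rfl⟩ := Nat.exists_eq_add_of_lt h1
      have h3' : c ^ (k * B + (u + 1)) % N = 1 % N := by
        rw [Nat.mod_eq_of_lt hN, ← add_assoc, h3]
      obtain ⟨u', g1, g2, g3, g4⟩ := htab (u + 1) (by omega) (by omega)
      have hg := pow_giant_eq (by omega) h3'
      refine ⟨u', g1, by omega, by rw [hg, g3], by omega, ?_⟩
      rw [pow_eq_one_of_giant_eq hcop (by omega) (hg.trans g4.symm), Nat.mod_eq_of_lt hN]
    rw [hkB'] at hfind
    -- the old value remains right if there is no period in the current block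
    have hold : (∀ m, k * B < m → m ≤ k * B + B → c ^ m % N ≠ 1) →
        IsLeastPeriod N B c k (s'.reg 29) := by
      intro hno
      refine ⟨hper.1.imp_right fun h => ⟨by omega, h.2⟩, fun m h1 h2 h3 => ?_⟩
      by_cases hm : m ≤ k * B + B
      · exact absurd h3 (hno m h1 hm)
      · exact hper.2 m (by omega) h2 h3
    set u := s.mem (c ^ (k * B + B + 1) % N) with hu
    have huB : u ≤ B := hmem _
    refine ⟨fun hu0 => ⟨by omega, vc_modpow hL hN hNL (by simpa using e0)
      (by simpa [e28] using hc) (by simp; omega) ?_⟩, fun hu0 => ?_⟩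
    · intro s₂ τ₂ h42₂ hfr₂ hm₂ hτ₂
      have f21 : s₂.reg 21 = k + 1 := by rw [hfr₂ 21 (by norm_num)]; simp [e21]
      have f20 : s₂.reg 20 = 1 := by rw [hfr₂ 20 (by norm_num)]; simp [e20]
      have f28 : s₂.reg 28 = c := by rw [hfr₂ 28 (by norm_num)]; simp [e28]
      have f29 : s₂.reg 29 = s'.reg 29 := by rw [hfr₂ 29 (by norm_num)]; simp [e29]
      have f25 : s₂.reg 25 = k * B + u := by rw [hfr₂ 25 (by norm_num)]; simp
      have f42 : s₂.reg 42 = c ^ (k * B + u) % N := by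
        rw [h42₂]; simp only [reg_setReg]; norm_num
      have fmem : s₂.mem = s.mem := by rw [hm₂]; simp [emem]
      have hfr₂' : ∀ r < 20, s₂.reg r = s.reg r := by
        intro r hr
        rw [hfr₂ r (by omega)]
        simp only [reg_setReg]
        simp only [show r ≠ 41 by omega, show r ≠ 40 by omega, show r ≠ 25 by omega,
          show r ≠ 24 by omega, if_false, hfr₁' r hr]
      -- a power of a unit is not zero, so that truncated subtraction tests for one
      have hpos : c ^ (k * B + u) % N ≠ 0 := by
        intro h
        have hd := Nat.dvd_of_mod_eq_zero h
        have := Nat.Coprime.eq_one_of_dvd (hcop.symm.pow_right (k * B + u)) hd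
        omega
      simp only [vc_block_nil, vc_block_cons, vc_arith, vc_mov, vc_cond, vc_skip, Op.Fits,
        Op.eval, reg_setReg, mem_setReg]
      norm_num
      simp only [f21, f20, f28, f29, f25, f42, fmem, true_and, add_tsub_cancel_right]
      refine ⟨fun hne => ⟨⟨by omega, hold fun m h1 h2 h3 => ?_, fun r hr => ?_⟩, by omega⟩,
        fun heq => ⟨⟨by omega, ⟨Or.inr ⟨by omega, by omega, by omega⟩,
          fun m h1 h2 h3 => ?_⟩, fun r hr => ?_⟩, by omega⟩⟩
      · obtain ⟨u', g1, g2, g3, g4, g5⟩ := hfind m h1 h2 h3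
        rw [← g3] at g5
        omega
      · rw [if_neg (by omega), if_neg (by omega), hfr₂' r hr]
      · refine ⟨by omega, ?_⟩
        by_cases hm : m ≤ k * B + B
        · obtain ⟨u', g1, g2, g3, g4, g5⟩ := hfind m h1 hm h3
          omega
        · omega
      · rw [if_neg (by omega), if_neg (by omega), if_neg (by omega), hfr₂' r hr]
    · refine ⟨⟨by omega, hold fun m h1 h2 h3 => ?_, fun r hr => ?_⟩, by omega⟩
      · obtain ⟨u', g1, g2, g3, g4, g5⟩ := hfind m h1 h2 h3
        omega
      · rw [if_neg (by omega), if_neg (by omega), hfr₁' r hr]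
  · rintro s' τ' ⟨h21, -, h20, h28, hper, hm, hfr⟩ hτ
    exact hQ _ _ hper hm hfr (by rw [mul_comm B] at hτ; omega)

/-- `reg 29` := the least exponent `n` in `[1, B * B]` with `(reg 28) ^ n = 1` modulo `N`, and
`0` if there is none. -/
def order : Prog := block [babySteps, giantSteps]

theorem vc_order {L N B c τ : ℕ} {Q : State → ℕ → Prop} {s : State} (hL : 1 < L)
    (hN : 1 < N) (hNL : N * N ≤ 2 ^ L) (hBL : B * B + B + 1 < 2 ^ L) (hcop : c.Coprime N)
    (h0 : s.reg 0 = N) (h2 : s.reg 2 = B) (h28 : s.reg 28 = c) (hc : c < N)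
    (hmem : ∀ i, s.mem i ≤ B)
    (hQ : ∀ s' τ', IsLeastPeriod N B c 0 (s'.reg 29) → (∀ i, s'.mem i ≤ B) →
      (∀ r < 20, s'.reg r = s.reg r) → τ' ≤ τ + 120 * L * B + 25 → Q s' τ') :
    vc L order Q s τ := by
  simp only [order, vc_block_cons]
  refine vc_babySteps hL hN hNL (by omega) h0 h2 h28 hc hmem ?_
  intro s₁ τ₁ htab hm h28₁ hfr hτ
  refine vc_giantSteps hL hN hNL hBL hcop (by rw [hfr 0 (by norm_num), h0])
    (by rw [hfr 2 (by norm_num), h2]) h28₁ hc hm htab ?_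
  intro s₂ τ₂ hper hm₂ hfr₂ hτ₂
  refine hQ _ _ hper (by rwa [hm₂]) (fun r hr => (hfr₂ r hr).trans (hfr r hr)) ?_
  have : 120 * L * B = 40 * L * B + 80 * L * B := by ring
  omega

end RAM

/-! ### Number theory -/

/-- If `c = a ^ M` satisfies `c ^ (q * k) = 1` and `c ^ k ≠ 1`, then the `q`-part of the order of
`a ^ (M' * k)` is one factor `q` larger than that of `M = q ^ f * M'`, and there is no other
part. Multiplying an element of order `M` by it gives one of order `M * q`. -/
theorem orderOf_mul_pow_eq {G : Type*} [CommMonoid G] {g a : G} {M M' q f k : ℕ} (hq : q.Prime)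
    (hM : M = q ^ f * M') (hM' : ¬ q ∣ M') (hM0 : 0 < M) (hg : orderOf g = M)
    (h1 : (a ^ M) ^ (q * k) = 1) (h2 : (a ^ M) ^ k ≠ 1) :
    orderOf (g * a ^ (M' * k)) = M * q := by
  set b := a ^ (M' * k) with hb
  have hbk : b ^ q ^ f = (a ^ M) ^ k := by
    rw [hb, hM, ← pow_mul, ← pow_mul]; congr 1; ring
  have hbo : orderOf b = q ^ (f + 1) := by
    have : Fact q.Prime := ⟨hq⟩
    refine orderOf_eq_prime_pow (by rwa [hbk]) ?_
    rw [pow_succ, pow_mul, hbk, ← pow_mul, mul_comm k, h1]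
  have hMq : M * q = q ^ (f + 1) * M' := by rw [hM]; ring
  refine orderOf_eq_of_pow_and_pow_div_prime (Nat.mul_pos hM0 hq.pos) ?_ ?_
  · rw [mul_pow, orderOf_dvd_iff_pow_eq_one.1 (by rw [hg]; exact Dvd.intro _ rfl),
      orderOf_dvd_iff_pow_eq_one.1 (by rw [hbo, hMq]; exact Dvd.intro _ rfl), one_mul]
  · intro r hr hrd h
    rw [mul_pow] at h
    by_cases hrq : r = q
    · subst hrq
      rw [Nat.mul_div_cancel _ hq.pos,
        orderOf_dvd_iff_pow_eq_one.1 (by rw [hg]), one_mul] at h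
      have hd := orderOf_dvd_of_pow_eq_one h
      rw [hbo, hM, pow_succ] at hd
      exact hM' (Nat.dvd_of_mul_dvd_mul_left (pow_pos hq.pos f) hd)
    · have hcop : r.Coprime q := (Nat.coprime_primes hr hq).2 hrq
      have hrM' : r ∣ M' := by
        rw [hMq] at hrd
        exact (hcop.pow_right _).dvd_of_dvd_mul_left hrd
      obtain ⟨w, rfl⟩ := hrM'
      have hdiv : M * q / r = q ^ (f + 1) * w := by
        rw [hMq, show q ^ (f + 1) * (r * w) = r * (q ^ (f + 1) * w) by ring,
          Nat.mul_div_cancel_left _ hr.pos]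
      have hb1 : b ^ (q ^ (f + 1) * w) = 1 :=
        orderOf_dvd_iff_pow_eq_one.1 (by rw [hbo]; exact Dvd.intro _ rfl)
      rw [hdiv, hb1, mul_one] at h
      have hd := orderOf_dvd_of_pow_eq_one h
      have hw : 0 < q ^ f * w := by
        rcases Nat.eq_zero_or_pos (q ^ f * w) with h0 | h0
        · have : M = r * (q ^ f * w) := by rw [hM]; ring
          rw [this, h0] at hM0
          omega
        · exact h0
      rw [hg, hM, show q ^ f * (r * w) = q ^ f * w * r by ring,
        show q ^ (f + 1) * w = q ^ f * w * q by ring] at hd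
      have hrq' := Nat.dvd_of_mul_dvd_mul_left hw hd
      exact hrq ((Nat.prime_dvd_prime_iff_eq hr hq).1 hrq')

/-- At least a quarter of the pairs of numbers up to `B` are coprime, because
`∑ 1 / d ^ 2 < 3 / 4` over `d ≥ 2`. -/
theorem sq_le_four_mul_card_coprime (B : ℕ) :
    B * B ≤ 4 * ((Finset.Icc 1 B ×ˢ Finset.Icc 1 B).filter fun z => z.1.Coprime z.2).card := by
  have hsum : ∀ n : ℕ, 2 ≤ n → ∑ d ∈ Finset.Icc 2 n, (1 : ℝ) / d ^ 2 ≤ 3 / 4 - 1 / n := by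
    intro n hn
    induction n, hn using Nat.le_induction with
    | base => norm_num
    | succ n hn ih =>
      rw [Finset.sum_Icc_succ_top (by omega)]
      have hn' : (2 : ℝ) ≤ n := by exact_mod_cast hn
      have : (1 : ℝ) / ((n + 1 : ℕ) : ℝ) ^ 2 ≤ 1 / n - 1 / ((n + 1 : ℕ) : ℝ) := by
        push_cast
        rw [div_sub_div _ _ (by positivity) (by positivity),
          div_le_div_iff₀ (by positivity) (by positivity)]
        nlinarith
      linarith
  rcases lt_or_ge B 2 with hB | hB
  · interval_cases B <;> decide
  set S := Finset.Icc 1 B ×ˢ Finset.Icc 1 B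
  have hcard : S.card = B * B := by simp [S]
  have hsplit := Finset.card_filter_add_card_filter_not (s := S) (fun z => z.1.Coprime z.2)
  have hbad : (S.filter fun z => ¬ z.1.Coprime z.2).card ≤
      ∑ d ∈ Finset.Icc 2 B, (B / d) * (B / d) := by
    have hsub : (S.filter fun z => ¬ z.1.Coprime z.2) ⊆ (Finset.Icc 2 B).biUnion fun d =>
        ((Finset.Ioc 0 B).filter fun x => d ∣ x) ×ˢ ((Finset.Ioc 0 B).filter fun x => d ∣ x) := by
      rintro ⟨x, y⟩ h
      simp only [S, Finset.mem_filter, Finset.mem_product, Finset.mem_Icc, Finset.mem_biUnion,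
        Finset.mem_Ioc] at h ⊢
      obtain ⟨⟨⟨hx, hxB⟩, hy, hyB⟩, hnc⟩ := h
      have hpos : 0 < x.gcd y := Nat.gcd_pos_of_pos_left _ hx
      have hle : x.gcd y ≤ x := Nat.gcd_le_left _ hx
      have : x.gcd y ≠ 1 := hnc
      exact ⟨x.gcd y, by omega, ⟨⟨by omega, hxB⟩, Nat.gcd_dvd_left _ _⟩, ⟨by omega, hyB⟩,
        Nat.gcd_dvd_right _ _⟩
    refine (Finset.card_le_card hsub).trans (Finset.card_biUnion_le.trans
      (Finset.sum_le_sum fun d _ => ?_))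
    rw [Finset.card_product, Nat.Ioc_filter_dvd_card_eq_div]
  have hreal : ((∑ d ∈ Finset.Icc 2 B, (B / d) * (B / d) : ℕ) : ℝ) ≤ 3 / 4 * (B * B) := by
    calc ((∑ d ∈ Finset.Icc 2 B, (B / d) * (B / d) : ℕ) : ℝ)
        ≤ ∑ d ∈ Finset.Icc 2 B, (B * B : ℝ) * (1 / d ^ 2) := by
          push_cast
          refine Finset.sum_le_sum fun d _ => ?_
          have h1 : ((B / d : ℕ) : ℝ) ≤ B / d := Nat.cast_div_le
          calc ((B / d : ℕ) : ℝ) * ((B / d : ℕ) : ℝ) ≤ (B / d : ℝ) * (B / d) := by gcongr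
            _ = _ := by ring
      _ = (B * B : ℝ) * ∑ d ∈ Finset.Icc 2 B, (1 : ℝ) / d ^ 2 := by rw [Finset.mul_sum]
      _ ≤ (B * B : ℝ) * (3 / 4) := by
          gcongr
          have := hsum B hB
          have h0 : (0 : ℝ) ≤ 1 / B := by positivity
          linarith
      _ = _ := by ring
  have hnat : 4 * ∑ d ∈ Finset.Icc 2 B, (B / d) * (B / d) ≤ 3 * (B * B) := by
    have : (4 : ℝ) * ((∑ d ∈ Finset.Icc 2 B, (B / d) * (B / d) : ℕ) : ℝ) ≤ 3 * (B * B) := by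
      linarith
    exact_mod_cast this
  omega

/-- A set of residues, all of them `M`-th roots of unity, has at most `M` elements. -/
theorem card_le_of_pow_eq_one {p M : ℕ} [Fact p.Prime] (hM : 0 < M) {α : Type*} {S : Finset α}
    (F : α → ZMod p) (hF : ∀ x ∈ S, F x ^ M = 1) (hinj : Set.InjOn F S) : S.card ≤ M := by
  classical
  rw [← Finset.card_image_of_injOn hinj]
  calc (S.image F).card ≤ (Polynomial.nthRoots M (1 : ZMod p)).toFinset.card := by
        refine Finset.card_le_card fun y hy => ?_
        obtain ⟨x, hx, rfl⟩ := Finset.mem_image.1 hy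
        rw [Multiset.mem_toFinset, Polynomial.mem_nthRoots hM]
        exact hF x hx
    _ ≤ (Polynomial.nthRoots M (1 : ZMod p)).card := Multiset.toFinset_card_le _
    _ ≤ M := Polynomial.card_nthRoots _ _

theorem natCast_inj_of_lt {p x y : ℕ} (hx : x < p) (hy : y < p)
    (h : (x : ZMod p) = y) : x = y := by
  rw [ZMod.natCast_eq_natCast_iff'] at h
  rwa [Nat.mod_eq_of_lt hx, Nat.mod_eq_of_lt hy] at h

/-- If all numbers up to `B` are `M`-th roots of unity modulo `p`, then so are the reduced
fractions formed from them. For `p > B ^ 2` these are distinct modulo `p`, and too many. -/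
theorem prime_le_sq {p B D M : ℕ} [Fact p.Prime] (hD : 4 * D < B * B) (hM : 0 < M) (hMD : M ≤ D)
    (hx : ∀ x, 1 ≤ x → x ≤ B → (x : ZMod p) ^ M = 1) : p ≤ B * B := by
  by_contra! hp
  have hcount := sq_le_four_mul_card_coprime B
  have hle := card_le_of_pow_eq_one (p := p) hM (S := (Finset.Icc 1 B ×ˢ Finset.Icc 1 B).filter
    fun z => z.1.Coprime z.2) (fun z => (z.1 : ZMod p) * (z.2 : ZMod p)⁻¹) ?_ ?_
  · omega
  · rintro ⟨x, y⟩ h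
    simp only [Finset.mem_filter, Finset.mem_product, Finset.mem_Icc] at h
    simp [mul_pow, hx x h.1.1.1 h.1.1.2, hx y h.1.2.1 h.1.2.2]
  · rintro ⟨x, y⟩ h ⟨x', y'⟩ h' heq
    simp only [Finset.coe_filter, Finset.mem_product, Finset.mem_Icc, Set.mem_ofPred_eq] at h h' heq
    obtain ⟨⟨⟨hx1, hxB⟩, hy1, hyB⟩, hc⟩ := h
    obtain ⟨⟨⟨hx1', hxB'⟩, hy1', hyB'⟩, hc'⟩ := h'
    have hne : ∀ y : ℕ, 1 ≤ y → y ≤ B → (y : ZMod p) ≠ 0 := by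
      intro y h1 h2 h0
      have := hx y h1 h2
      rw [h0, zero_pow hM.ne'] at this
      exact zero_ne_one this
    have hcross : ((x * y' : ℕ) : ZMod p) = (x' * y : ℕ) := by
      push_cast
      have h1 := hne y hy1 hyB
      have h2 := hne y' hy1' hyB'
      field_simp at heq
      linear_combination heq
    have hcross' := natCast_inj_of_lt ((Nat.mul_le_mul hxB hyB').trans_lt hp)
      ((Nat.mul_le_mul hxB' hyB).trans_lt hp) hcross
    have hxx : x = x' := Nat.dvd_antisymm
      (hc.dvd_of_dvd_mul_right (hcross' ▸ Dvd.intro _ rfl))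
      (hc'.dvd_of_dvd_mul_right (hcross' ▸ Dvd.intro _ rfl))
    subst hxx
    have : y' = y := Nat.eq_of_mul_eq_mul_left hx1 hcross'
    rw [this]

/-- Under the hypotheses of `prime_le_sq`, with `M ∣ p - 1` and `B < p`, the cofactor
`(p - 1) / M` is at most `B`, as `M ≥ B`. -/
theorem exists_eq_mul_add_one {p B D M : ℕ} [Fact p.Prime] (hD : 4 * D < B * B) (hM : 0 < M)
    (hMD : M ≤ D) (hx : ∀ x, 1 ≤ x → x ≤ B → (x : ZMod p) ^ M = 1) (hBp : B < p)
    (hdvd : M ∣ p - 1) : ∃ k, 0 < k ∧ k ≤ B ∧ p = k * M + 1 := by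
  have hp2 := prime_le_sq hD hM hMD hx
  have hMB : B ≤ M := by
    have hle := card_le_of_pow_eq_one (p := p) hM (S := Finset.Icc 1 B)
      (fun x => (x : ZMod p)) (fun x h => hx x (Finset.mem_Icc.1 h).1 (Finset.mem_Icc.1 h).2) ?_
    · simpa using hle
    · intro x h y h' heq
      have h := Finset.mem_Icc.1 (Finset.mem_coe.1 h)
      have h' := Finset.mem_Icc.1 (Finset.mem_coe.1 h')
      exact natCast_inj_of_lt (by omega) (by omega) heq
  have hp1 := (Fact.out : p.Prime).two_le
  obtain ⟨k, hk⟩ := hdvd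
  refine ⟨k, ?_, ?_, by rw [mul_comm, ← hk]; omega⟩
  · rcases Nat.eq_zero_or_pos k with h | h
    · simp [h] at hk; omega
    · exact h
  · by_contra! h
    have := Nat.mul_le_mul hMB h.le
    omega

theorem natCast_pow_eq_one {N p x e : ℕ} (hp : p ∣ N) (h : x ^ e % N = 1) :
    (x : ZMod p) ^ e = 1 := by
  have h1 : ((x ^ e : ℕ) : ZMod p) = ((x ^ e % N : ℕ) : ZMod p) := by
    rw [ZMod.natCast_eq_natCast_iff]
    exact ((Nat.mod_modEq _ _).symm).of_dvd hp
  rw [← Nat.cast_pow, h1, h, Nat.cast_one]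

theorem natCast_mod_eq {N p x : ℕ} (hp : p ∣ N) : ((x % N : ℕ) : ZMod p) = x := by
  rw [ZMod.natCast_eq_natCast_iff]
  exact (Nat.mod_modEq _ _).of_dvd hp

theorem natCast_pow_ne_one {N p x e : ℕ} [Fact p.Prime] (hp : p ∣ N) (hpos : 0 < x ^ e % N)
    (h : N.Coprime (x ^ e % N - 1)) : (x : ZMod p) ^ e ≠ 1 := by
  intro he
  have h1 : ((x ^ e % N - 1 : ℕ) : ZMod p) = 0 := by
    rw [Nat.cast_sub hpos, natCast_mod_eq hp, Nat.cast_pow, he, Nat.cast_one, sub_self]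
  exact (Fact.out : p.Prime).one_lt.ne'
    (Nat.eq_one_of_dvd_coprimes h hp ((ZMod.natCast_eq_zero_iff _ _).1 h1))

/-- An element of order `M > D` modulo every prime factor of `N` is a correct answer. -/
theorem correct_element {N D M g : ℕ} (hN : 1 < N) (hg : g < N) (hM : D < M)
    (h : ∀ p, p.Prime → p ∣ N → orderOf (g : ZMod p) = M) : (Answer.element g).Correct N D := by
  have hcop : g.Coprime N := by
    refine Nat.coprime_of_dvd fun p hp h1 h2 => ?_
    have : Fact p.Prime := ⟨hp⟩
    have ho := h p hp h2
    rw [(ZMod.natCast_eq_zero_iff _ _).2 h1, orderOf_zero] at ho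
    omega
  have : NeZero N := ⟨by omega⟩
  refine ⟨ZMod.unitOfCoprime g hcop, ?_, ?_⟩
  · rw [ZMod.coe_unitOfCoprime, ZMod.val_natCast, Nat.mod_eq_of_lt hg]
  · obtain ⟨p, hp, hpN⟩ := Nat.exists_prime_and_dvd (n := N) (by omega)
    have hd := orderOf_map_dvd (ZMod.castHom hpN (ZMod p)).toMonoidHom
      ((ZMod.unitOfCoprime g hcop : (ZMod N)ˣ) : ZMod N)
    rw [orderOf_units, ZMod.coe_unitOfCoprime] at hd
    have he : (ZMod.castHom hpN (ZMod p)).toMonoidHom (g : ZMod N) = (g : ZMod p) :=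
      map_natCast (ZMod.castHom hpN (ZMod p)) g
    rw [he, h p hp hpN] at hd
    exact hM.trans_le (Nat.le_of_dvd (orderOf_pos _) hd)

theorem correct_element_of_pow_ne_one {N D B c : ℕ} (hN : 1 < N) (hc : c < N)
    (hcop : c.Coprime N) (hD : D < B) (h : ∀ m, 0 < m → m ≤ B → c ^ m % N ≠ 1) :
    (Answer.element c).Correct N D := by
  have : NeZero N := ⟨by omega⟩
  refine ⟨ZMod.unitOfCoprime c hcop, ?_, ?_⟩
  · rw [ZMod.coe_unitOfCoprime, ZMod.val_natCast, Nat.mod_eq_of_lt hc]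
  · by_contra! hle
    refine h _ (orderOf_pos (ZMod.unitOfCoprime c hcop)) (by omega) ?_
    have h1 := pow_orderOf_eq_one (ZMod.unitOfCoprime c hcop)
    rw [← Units.val_inj, Units.val_pow_eq_pow_val, ZMod.coe_unitOfCoprime, Units.val_one,
      ← Nat.cast_pow, ← Nat.cast_one, ZMod.natCast_eq_natCast_iff'] at h1
    rwa [Nat.mod_eq_of_lt hN] at h1

namespace RAM

theorem IsLeastDivisor.correct_factor {N D M B r : ℕ} (hM : 0 < M) (hN : 0 < N)
    (h : IsLeastDivisor N M B 0 r) (hr : r ≠ N) : (Answer.factor r).Correct N D := by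
  rcases h with ⟨h, -⟩ | ⟨i, hi, -, h, hd, -⟩
  · exact absurd h hr
  · have := Nat.mul_pos hi hM
    exact ⟨hd, by omega, lt_of_le_of_ne (Nat.le_of_dvd hN hd) hr⟩

theorem IsLeastDivisor.prime_of_eq {N M B : ℕ} (hN : 1 < N)
    (hp : ∀ p, p.Prime → p ∣ N → ∃ k, 0 < k ∧ k ≤ B ∧ p = k * M + 1)
    (h : IsLeastDivisor N M B 0 N) : N.Prime := by
  by_contra hnp
  have hpr := Nat.minFac_prime hN.ne'
  obtain ⟨k, hk, hkB, he⟩ := hp _ hpr (Nat.minFac_dvd N)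
  have hlt : N.minFac < N := (Nat.not_prime_iff_minFac_lt hN).1 hnp
  rcases h with ⟨-, h⟩ | ⟨i, hi, hiB, h, -, hj⟩
  · exact h k hk hkB (he ▸ Nat.minFac_dvd N)
  · refine hj k hk ?_ (he ▸ Nat.minFac_dvd N)
    by_contra! hik
    have := Nat.mul_le_mul_right M hik
    omega

/-- For `n ≤ B * B` the least divisor between `2` and `B + 1`, if there is one, and `n`
otherwise, is the least prime factor. -/
theorem IsLeastDivisor.prime_dvd {n B r : ℕ} (hn : 1 < n) (hnB : n ≤ B * B)
    (h : IsLeastDivisor n 1 B 0 r) : r.Prime ∧ r ∣ n := by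
  rcases h with ⟨rfl, h⟩ | ⟨i, hi, hiB, rfl, hd, hj⟩
  · refine ⟨?_, dvd_rfl⟩
    by_contra hnp
    have hsq := Nat.minFac_sq_le_self (by omega) hnp
    have hpr := Nat.minFac_prime hn.ne'
    have h2 := hpr.two_le
    have hle : r.minFac ≤ B := by nlinarith
    refine h (r.minFac - 1) (by omega) (by omega) ?_
    rw [mul_one, Nat.sub_add_cancel (by omega)]
    exact Nat.minFac_dvd r
  · refine ⟨?_, hd⟩
    by_contra hnp
    have h1 : 1 < i * 1 + 1 := by omega
    have hlt := (Nat.not_prime_iff_minFac_lt h1).1 hnp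
    have h2 := (Nat.minFac_prime h1.ne').two_le
    refine hj ((i * 1 + 1).minFac - 1) (by omega) (by omega) ?_
    rw [mul_one, Nat.sub_add_cancel (by omega)]
    exact (Nat.minFac_dvd _).trans hd

/-- If trial division finds no proper divisor of `N > B + 1` up to `B + 1`, then the numbers up
to `B` are prime to `N`. -/
theorem IsLeastDivisor.coprime {N B x : ℕ} (hB : B + 1 < N) (h : IsLeastDivisor N 1 B 0 N)
    (hx : 0 < x) (hxB : x ≤ B) : x.Coprime N := by
  rcases h with ⟨-, h⟩ | ⟨i, hi, hiB, h, -, -⟩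
  · refine Nat.coprime_of_dvd fun p hp h1 h2 => ?_
    have := Nat.le_of_dvd hx h1
    have h2' := hp.two_le
    refine h (p - 1) (by omega) (by omega) ?_
    rwa [mul_one, Nat.sub_add_cancel (by omega)]
  · omega

end RAM

namespace RAM

/-! ### Enlarging the order -/

/-- The situation of the main loop: `B` is a little larger than `2 * √D`, the input `N` exceeds
`B ^ 2`, and `L` bits suffice for products of two residues. -/
structure Params (L N D B : ℕ) : Prop where
  one_lt : 1 < L
  pos : 0 < D
  lt_sq : 4 * D < B * B
  sq_lt : B * B < N
  le_two_pow : N * N ≤ 2 ^ L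

namespace Params

variable {L N D B : ℕ} (P : Params L N D B)
include P

theorem le_B : 3 ≤ B := by
  by_contra! h
  have h1 := P.pos
  have h2 := P.lt_sq
  have : B * B ≤ 2 * 2 := Nat.mul_le_mul (by omega) (by omega)
  omega

theorem D_lt : D < N := by
  have h2 := P.lt_sq
  have h3 := P.sq_lt
  omega

theorem le_N : 10 ≤ N := by
  have h1 := P.le_B
  have h3 := P.sq_lt
  nlinarith

theorem mul_lt {x y : ℕ} (hx : x < N) (hy : y < N) : x * y < 2 ^ L :=
  (Nat.mul_lt_mul'' hx hy).trans_le P.le_two_pow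

theorem sq_add_lt : B * B + B + 1 < 2 ^ L := by
  have h1 := P.le_B
  have h3 := P.sq_lt
  have h4 := P.le_N
  have h5 := P.le_two_pow
  nlinarith

theorem N_lt : N < 2 ^ L := by
  have h4 := P.le_N
  have h5 := P.le_two_pow
  nlinarith

end Params

/-- Registers `8` and `9` hold the tag and the value of a correct answer. -/
def Answered (N D : ℕ) (s : State) : Prop :=
  (s.reg 8 = 0 ∧ (Answer.element (s.reg 9)).Correct N D) ∨
    (s.reg 8 = 1 ∧ (Answer.factor (s.reg 9)).Correct N D) ∨
    (s.reg 8 = 2 ∧ Answer.prime.Correct N D)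

/-- The state of the search: `g` has order `M ≤ D` modulo every prime factor of `N`, and the
numbers in `(a, B]` are `M`-th roots of unity. At most `h` further doublings of `M` are
possible. -/
structure Search (N D B h M g a : ℕ) : Prop where
  pos : 0 < M
  le : M ≤ D
  lt : D < M * 2 ^ h
  g_lt : g < N
  orderOf : ∀ p, p.Prime → p ∣ N → orderOf (g : ZMod p) = M
  a_le : a ≤ B
  pow_eq : ∀ x, a < x → x ≤ B → x ^ M % N = 1

/-- The invariant of the main loop: the search goes on, or an answer has been found. -/
structure LoopInv (N D B h : ℕ) (s : State) : Prop where
  reg0 : s.reg 0 = N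
  reg1 : s.reg 1 = D
  reg2 : s.reg 2 = B
  mem : ∀ i, s.mem i ≤ B
  search : (s.reg 7 = 1 ∧ s.reg 6 = 0 ∧ Answered N D s) ∨
    (s.reg 7 = 0 ∧ Search N D B h (s.reg 4) (s.reg 5) (s.reg 6))

/-- Record the answer with the given tag and the value `reg x`, and stop the main loop. -/
def finish (tag x : ℕ) : Prog := block [.const 8 tag, mov 9 x, .const 7 1, .const 6 0]

/-- `reg 15` := the largest divisor of `reg 4` prime to the prime `reg 11`; `reg 13 = 1`. -/
def strip : Prog := block [mov 15 4, .arith .mod 16 15 11, .arith .sub 16 13 16,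
  .loop 16 (block [.arith .div 15 15 11, .arith .mod 16 15 11, .arith .sub 16 13 16])]

theorem vc_strip {L M q τ : ℕ} {Q : State → ℕ → Prop} {s : State} (hL : 1 < L) (hM : 0 < M)
    (hML : M < 2 ^ L) (hq : 1 < q) (h4 : s.reg 4 = M) (h11 : s.reg 11 = q) (h13 : s.reg 13 = 1)
    (hQ : ∀ s' τ' f, M = q ^ f * s'.reg 15 → ¬ q ∣ s'.reg 15 →
      (∀ r, r ≠ 15 → r ≠ 16 → s'.reg r = s.reg r) → s'.mem = s.mem → τ' ≤ τ + 10 * L + 10 →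
      Q s' τ') : vc L strip Q s τ := by
  simp only [strip, vc_block_cons, vc_arith, vc_mov, Op.Fits, Op.eval, reg_setReg]
  norm_num
  simp only [h4, h11, h13]
  refine vc_loop (by omega) (b := 10 * L) (fun s' b => ∃ m f, b = 10 * m ∧ s'.reg 15 < 2 ^ m ∧
    0 < s'.reg 15 ∧ M = q ^ f * s'.reg 15 ∧ s'.reg 16 = 1 - s'.reg 15 % q ∧
    (∀ r, r ≠ 15 → r ≠ 16 → s'.reg r = s.reg r) ∧ s'.mem = s.mem) ?_ ?_ ?_
  · refine ⟨L, 0, rfl, ?_⟩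
    simp only [reg_setReg, mem_setReg]
    norm_num
    refine ⟨hML, hM, fun r h1 h2 => ?_⟩
    simp only [h1, h2, if_false]
  · rintro s' _ ⟨m, f, rfl, hlt, hpos, hMf, h16, hfr, hmem⟩ hne
    have e11 : s'.reg 11 = q := by rw [hfr 11 (by norm_num) (by norm_num), h11]
    have e13 : s'.reg 13 = 1 := by rw [hfr 13 (by norm_num) (by norm_num), h13]
    obtain ⟨w, hw⟩ : q ∣ s'.reg 15 := Nat.dvd_of_mod_eq_zero (by omega)
    have hw0 : 0 < w := by
      rcases Nat.eq_zero_or_pos w with h | h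
      · simp [h] at hw; omega
      · exact h
    obtain ⟨m, rfl⟩ : ∃ k, m = k + 1 := by
      rcases m with _ | k
      · simp at hlt; omega
      · exact ⟨k, rfl⟩
    have hwm : w < 2 ^ m := by
      rw [pow_succ, hw] at hlt
      nlinarith
    have hdiv : s'.reg 15 / q = w := by rw [hw, Nat.mul_div_cancel_left _ (by omega)]
    simp only [vc_block_cons, vc_block_nil, vc_arith, Op.Fits, Op.eval, reg_setReg, mem_setReg,
      Nat.reduceEqDiff, if_true, if_false, e11, e13, hdiv, true_and]
    refine ⟨_, ⟨m, f + 1, rfl, hwm, hw0, ?_, fun r h1 h2 => ?_, hmem⟩, by omega⟩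
    · rw [hMf, hw]; ring
    · simp only [h1, h2, if_false, hfr r h1 h2]
  · rintro s' _ τ' ⟨m, f, rfl, hlt, hpos, hMf, h16, hfr, hmem⟩ hz hτ
    refine hQ _ _ f hMf (fun hd => ?_) hfr hmem (by omega)
    have := Nat.mod_eq_zero_of_dvd hd
    omega

/-- With `q = reg 11` and `k = reg 12`, multiply `g` by `a ^ (M' * k)`, where `M'` is the part of
`M` prime to `q`, and `M` by `q`. If `M > D` now, then `g` is the answer. -/
def extend : Prog := block [strip, .arith .mul 17 15 12, mov 40 6, mov 41 17, modpow,
  .arith .mul 5 5 42, .arith .mod 5 5 0, .arith .mul 4 4 11, .arith .sub 18 4 1,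
  .cond 18 (finish 0 5) .skip]

theorem vc_extend {L N D B h M g a q k τ : ℕ} {Q : State → ℕ → Prop} {s : State}
    (P : Params L N D B) (S : Search N D B h M g a) (h0 : s.reg 0 = N) (h1 : s.reg 1 = D)
    (h2 : s.reg 2 = B) (h4 : s.reg 4 = M) (h5 : s.reg 5 = g) (h6 : s.reg 6 = a)
    (h7 : s.reg 7 = 0) (h11 : s.reg 11 = q) (h12 : s.reg 12 = k) (h13 : s.reg 13 = 1)
    (hmem : ∀ i, s.mem i ≤ B) (hq : q.Prime) (hqN : q < N) (hkN : k < N)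
    (hone : ∀ p, p.Prime → p ∣ N → ((a : ZMod p) ^ M) ^ (q * k) = 1)
    (hne : ∀ p, p.Prime → p ∣ N → ((a : ZMod p) ^ M) ^ k ≠ 1)
    (hQ : ∀ s' τ' h', h = h' + 1 → LoopInv N D B h' s' → τ' ≤ τ + 30 * L + 50 → Q s' τ') :
    vc L extend Q s τ := by
  have hMN : M < N := S.le.trans_lt P.D_lt
  have hN := P.le_N
  have hBN : B < N := by have := P.le_B; have := P.sq_lt; nlinarith
  simp only [extend, vc_block_cons]
  refine vc_strip P.one_lt S.pos (hMN.trans P.N_lt) hq.one_lt h4 h11 h13 ?_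
  intro s₁ τ₁ f hf hnd hfr₁ hm₁ hτ₁
  have e0 : s₁.reg 0 = N := by rw [hfr₁ 0 (by norm_num) (by norm_num), h0]
  have e6 : s₁.reg 6 = a := by rw [hfr₁ 6 (by norm_num) (by norm_num), h6]
  have e12 : s₁.reg 12 = k := by rw [hfr₁ 12 (by norm_num) (by norm_num), h12]
  generalize hM' : s₁.reg 15 = M' at hf hnd
  have hM'N : M' < N := by
    refine lt_of_le_of_lt (Nat.le_of_dvd S.pos ?_) hMN
    rw [hf]; exact Dvd.intro_left _ rfl
  simp only [vc_block_cons, vc_arith, vc_mov, Op.Fits, Op.eval, reg_setReg, Nat.reduceEqDiff,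
    if_true, if_false, hM', e12, e6]
  refine ⟨P.mul_lt hM'N hkN, vc_modpow P.one_lt (by omega) P.le_two_pow (by simpa using e0)
    (by simpa using S.a_le.trans_lt hBN) (by simpa using P.mul_lt hM'N hkN) ?_⟩
  intro s₂ τ₂ h42 hfr₂ hm₂ hτ₂
  simp only [reg_setReg, Nat.reduceEqDiff, if_true, if_false] at h42
  have hfr : ∀ r < 15, s₂.reg r = s.reg r := by
    intro r hr
    rw [hfr₂ r (by omega)]
    simp only [reg_setReg]
    simp only [show r ≠ 41 by omega, show r ≠ 40 by omega, show r ≠ 17 by omega, if_false]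
    exact hfr₁ r (by omega) (by omega)
  have f0 := (hfr 0 (by norm_num)).trans h0
  have f1 := (hfr 1 (by norm_num)).trans h1
  have f2 := (hfr 2 (by norm_num)).trans h2
  have f4 := (hfr 4 (by norm_num)).trans h4
  have f5 := (hfr 5 (by norm_num)).trans h5
  have f6 := (hfr 6 (by norm_num)).trans h6
  have f7 := (hfr 7 (by norm_num)).trans h7
  have f11 := (hfr 11 (by norm_num)).trans h11
  have fmem : ∀ i, s₂.mem i ≤ B := by rw [hm₂]; simpa [hm₁] using hmem
  have hNpos : 0 < N := by omega
  have horder : ∀ p, p.Prime → p ∣ N →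
      orderOf ((g * (a ^ (M' * k) % N) % N : ℕ) : ZMod p) = M * q := by
    intro p hp hpN
    rw [natCast_mod_eq hpN, Nat.cast_mul, natCast_mod_eq hpN, Nat.cast_pow]
    exact orderOf_mul_pow_eq hq hf hnd S.pos (S.orderOf p hp hpN) (hone p hp hpN)
      (hne p hp hpN)
  obtain ⟨h', rfl⟩ : ∃ h', h = h' + 1 := by
    rcases h with _ | h'
    · have := S.lt; have := S.le; omega
    · exact ⟨h', rfl⟩
  simp only [finish, vc_block_cons, vc_block_nil, vc_arith, vc_mov, vc_cond, vc_const, vc_skip,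
    Op.Fits, Op.eval, reg_setReg, Nat.reduceEqDiff, if_true, if_false, f0, f1, f4, f5, f11, h42,
    true_and]
  have hgb : g * (a ^ (M' * k) % N) < 2 ^ L := P.mul_lt S.g_lt (Nat.mod_lt _ hNpos)
  have h2L := P.sq_add_lt
  refine ⟨hgb, P.mul_lt hMN hqN, fun hgt => ⟨by omega, by omega, by omega, ?_⟩, fun hle => ?_⟩
  · refine hQ _ _ h' rfl ⟨?_, ?_, ?_, ?_, Or.inl ⟨?_, ?_, Or.inl ⟨?_, ?_⟩⟩⟩ (by omega)
    · simp [f0]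
    · simp [f1]
    · simp [f2]
    · simpa using fmem
    · simp
    · simp
    · simp
    · simp only [reg_setReg, Nat.reduceEqDiff, if_true, if_false]
      exact correct_element (by omega) (Nat.mod_lt _ hNpos) (by omega) horder
  · refine hQ _ _ h' rfl ⟨?_, ?_, ?_, ?_, Or.inr ⟨?_, ?_⟩⟩ (by omega)
    · simp [f0]
    · simp [f1]
    · simp [f2]
    · simpa using fmem
    · simp [f7]
    · simp only [reg_setReg, Nat.reduceEqDiff, if_true, if_false, f6]
      refine ⟨Nat.mul_pos S.pos hq.pos, by omega, ?_, Nat.mod_lt _ hNpos, horder, S.a_le,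
        fun x hx hxB => ?_⟩
      · have hlt := S.lt
        have h3 : M * 2 * 2 ^ h' ≤ M * q * 2 ^ h' := by
          have := hq.two_le
          gcongr
        have h4 : M * 2 ^ (h' + 1) = M * 2 * 2 ^ h' := by ring
        omega
      · rw [pow_mul, Nat.pow_mod, S.pow_eq x hx hxB, one_pow, Nat.mod_eq_of_lt (by omega)]

/-- With `n = reg 29` the order of `c = reg 10` modulo `N`, let `q` be the least prime factor of
`n` and `k = n / q`. If `c ^ k - 1` is not prime to `N`, a factor of `N` is found. -/
def reduce : Prog := block [mov 30 29, .const 31 1, leastDivisor, mov 11 32, .arith .div 12 29 11,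
  mov 40 10, mov 41 12, modpow, .const 13 1, .arith .sub 31 42 13, mov 30 0, euclid,
  .arith .sub 14 30 13, .cond 14 (finish 1 30) extend]

/-- Enlarge `M` by means of `c = reg 10 = a ^ M`, unless this already gives an answer. -/
def grow : Prog := block [mov 28 10, order, .cond 29 reduce (finish 0 10)]

theorem vc_reduce {L N D B h M g a c n τ : ℕ} {Q : State → ℕ → Prop} {s : State}
    (P : Params L N D B) (S : Search N D B h M g a) (h0 : s.reg 0 = N) (h1 : s.reg 1 = D)
    (h2 : s.reg 2 = B) (h4 : s.reg 4 = M) (h5 : s.reg 5 = g) (h6 : s.reg 6 = a)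
    (h7 : s.reg 7 = 0) (h10 : s.reg 10 = c) (h29 : s.reg 29 = n)
    (hmem : ∀ i, s.mem i ≤ B) (hc : c = a ^ M % N) (hcop : c.Coprime N) (hc1 : c ≠ 1)
    (hper : IsLeastPeriod N B c 0 n) (hn : n ≠ 0)
    (hQ : ∀ s' τ' h', h = h' + 1 → LoopInv N D B h' s' →
      τ' ≤ τ + 60 * L + 10 * B + 100 → Q s' τ') :
    vc L reduce Q s τ := by
  have hN := P.le_N
  have hB3 := P.le_B
  have hBL := P.sq_add_lt
  have hBN := P.sq_lt
  have hL := P.one_lt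
  have hNpos : 0 < N := by omega
  have hcN : c < N := hc ▸ Nat.mod_lt _ hNpos
  obtain ⟨-, hnB, hcn⟩ := hper.1.resolve_left hn
  have hn0 : 0 < n := Nat.pos_of_ne_zero hn
  have hn1 : 1 < n := by
    rcases Nat.lt_or_ge 1 n with h | h
    · exact h
    · have : n = 1 := by omega
      rw [this, pow_one, Nat.mod_eq_of_lt hcN] at hcn
      exact absurd hcn hc1
  simp only [reduce, vc_block_cons, vc_const, vc_mov]
  refine ⟨by omega, vc_leastDivisor (n := n) (M := 1) (B := B) (by omega) (by simpa using h2)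
    (by simpa using h29) (by simp) (by omega) ?_⟩
  intro s₁ τ₁ hld hfr₁ hm₁ hτ₁
  obtain ⟨hq, k, hk⟩ := hld.prime_dvd hn1 hnB
  have hfr₁' : ∀ r < 30, s₁.reg r = s.reg r := by
    intro r hr
    rw [hfr₁ r hr]
    simp only [reg_setReg]
    rw [if_neg (by omega), if_neg (by omega)]
  have e0 := (hfr₁' 0 (by norm_num)).trans h0
  have e10 := (hfr₁' 10 (by norm_num)).trans h10
  have e29 := (hfr₁' 29 (by norm_num)).trans h29
  generalize hq' : s₁.reg 32 = q at hq hk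
  have hdiv : n / q = k := by rw [hk, Nat.mul_div_cancel_left _ hq.pos]
  have hk0 : 0 < k := by
    rcases Nat.eq_zero_or_pos k with h | h
    · simp [h] at hk; omega
    · exact h
  have hq2 := hq.two_le
  have hkn : k < n := by
    have := Nat.mul_le_mul_right k hq2
    omega
  have hqn : q ≤ n := Nat.le_of_dvd hn0 (hk ▸ Dvd.intro _ rfl)
  simp only [vc_block_cons, vc_arith, vc_mov, Op.Fits, Op.eval, reg_setReg, Nat.reduceEqDiff,
    if_true, if_false, hq', e10, e29, hdiv, true_and]
  refine vc_modpow P.one_lt (by omega) P.le_two_pow (by simpa using e0) (by simpa using hcN)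
    (by simp; omega) ?_
  intro s₂ τ₂ h42 hfr₂ hm₂ hτ₂
  simp only [reg_setReg, Nat.reduceEqDiff, if_true, if_false] at h42
  have hfr₂' : ∀ r < 11, s₂.reg r = s.reg r := by
    intro r hr
    rw [hfr₂ r (by omega)]
    simp only [reg_setReg]
    simp only [show r ≠ 41 by omega, show r ≠ 40 by omega, show r ≠ 12 by omega,
      show r ≠ 11 by omega, if_false]
    exact hfr₁' r (by omega)
  have f0 := (hfr₂' 0 (by norm_num)).trans h0
  have f11 : s₂.reg 11 = q := by rw [hfr₂ 11 (by norm_num)]; simp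
  have f12 : s₂.reg 12 = k := by rw [hfr₂ 12 (by norm_num)]; simp
  -- `c` is a unit and `n` is its exact order
  have hpos : 0 < c ^ k % N := by
    refine Nat.pos_of_ne_zero fun h => ?_
    have := Nat.Coprime.eq_one_of_dvd (hcop.symm.pow_right k) (Nat.dvd_of_mod_eq_zero h)
    omega
  have hlt : c ^ k % N < N := Nat.mod_lt _ hNpos
  have hck : c ^ k % N ≠ 1 := by
    intro h
    have := (hper.2 k (by omega) (by omega) h).2
    omega
  simp only [vc_block_cons, vc_arith, vc_mov, vc_const, Op.Fits, Op.eval, reg_setReg,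
    Nat.reduceEqDiff, if_true, if_false, h42, f0, true_and]
  refine ⟨by omega, vc_euclid (m := L) (by omega) ?_ ?_ ?_⟩
  · simp only [reg_setReg, Nat.reduceEqDiff, if_true, if_false]; omega
  · simp only [reg_setReg, Nat.reduceEqDiff, if_true, if_false]
    calc N * (c ^ k % N - 1) < N * N := Nat.mul_lt_mul_of_pos_left (by omega) hNpos
      _ ≤ 2 ^ L := P.le_two_pow
  intro s₃ τ₃ h30 hfr₃ hm₃ hτ₃
  simp only [reg_setReg, Nat.reduceEqDiff, if_true, if_false] at h30
  have hfr₃' : ∀ r < 11, s₃.reg r = s.reg r := by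
    intro r hr
    rw [hfr₃ r (by omega)]
    simp only [reg_setReg]
    simp only [show r ≠ 30 by omega, show r ≠ 31 by omega, show r ≠ 13 by omega, if_false]
    exact hfr₂' r hr
  have g0 := (hfr₃' 0 (by norm_num)).trans h0
  have g1 := (hfr₃' 1 (by norm_num)).trans h1
  have g2 := (hfr₃' 2 (by norm_num)).trans h2
  have g4 := (hfr₃' 4 (by norm_num)).trans h4
  have g5 := (hfr₃' 5 (by norm_num)).trans h5
  have g6 := (hfr₃' 6 (by norm_num)).trans h6
  have g7 := (hfr₃' 7 (by norm_num)).trans h7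
  have g11 : s₃.reg 11 = q := by rw [hfr₃ 11 (by norm_num)]; simp [f11]
  have g12 : s₃.reg 12 = k := by rw [hfr₃ 12 (by norm_num)]; simp [f12]
  have g13 : s₃.reg 13 = 1 := by rw [hfr₃ 13 (by norm_num)]; simp
  have gmem : ∀ i, s₃.mem i ≤ B := by
    rw [hm₃]; simp only [mem_setReg]; rw [hm₂]; simp only [mem_setReg]; rw [hm₁]; exact hmem
  have hgcd : 0 < N.gcd (c ^ k % N - 1) := Nat.gcd_pos_of_pos_left _ hNpos
  simp only [vc_block_cons, vc_arith, vc_cond, Op.Fits, Op.eval, reg_setReg, if_true, h30, g13,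
    true_and]
  obtain ⟨h', rfl⟩ : ∃ h', h = h' + 1 := by
    rcases h with _ | h'
    · have := S.lt; have := S.le; omega
    · exact ⟨h', rfl⟩
  constructor
  · intro hne
    simp only [finish, vc_block_cons, vc_block_nil, vc_const, vc_mov, reg_setReg,
      Nat.reduceEqDiff, if_false, h30]
    refine ⟨by omega, by omega, by omega, ?_⟩
    refine hQ _ _ h' rfl ⟨?_, ?_, ?_, ?_, Or.inl ⟨?_, ?_, Or.inr (Or.inl ⟨?_, ?_⟩)⟩⟩ (by omega)
    · simp [g0]
    · simp [g1]
    · simp [g2]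
    · simpa using gmem
    · simp
    · simp
    · simp
    · simp only [reg_setReg, Nat.reduceEqDiff, if_true, if_false]
      refine ⟨Nat.gcd_dvd_left _ _, by omega, ?_⟩
      have := Nat.gcd_le_right N (show 0 < c ^ k % N - 1 by omega)
      omega
  · intro heq
    have hcast : ∀ p, p ∣ N → (c : ZMod p) = (a : ZMod p) ^ M := by
      intro p hp
      rw [hc, natCast_mod_eq hp, Nat.cast_pow]
    refine vc_extend P S (q := q) (k := k) (by simpa using g0) (by simpa using g1)
      (by simpa using g2) (by simpa using g4) (by simpa using g5) (by simpa using g6)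
      (by simpa using g7) (by simpa using g11) (by simpa using g12) (by simpa using g13)
      (by simpa using gmem) hq (by omega) (by omega) ?_ ?_ ?_
    · intro p hp hpN
      rw [← hcast p hpN, ← hk]
      exact natCast_pow_eq_one hpN hcn
    · intro p hp hpN
      have : Fact p.Prime := ⟨hp⟩
      rw [← hcast p hpN]
      refine natCast_pow_ne_one hpN hpos ?_
      rw [Nat.Coprime]; omega
    · intro s' τ' h'' hh hI hτ'
      exact hQ s' _ h'' hh hI (by omega)

theorem vc_grow {L N D B h M g a c τ : ℕ} {Q : State → ℕ → Prop} {s : State}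
    (P : Params L N D B) (S : Search N D B h M g a) (h0 : s.reg 0 = N) (h1 : s.reg 1 = D)
    (h2 : s.reg 2 = B) (h4 : s.reg 4 = M) (h5 : s.reg 5 = g) (h6 : s.reg 6 = a)
    (h7 : s.reg 7 = 0) (h10 : s.reg 10 = c)
    (hmem : ∀ i, s.mem i ≤ B) (hc : c = a ^ M % N) (hcop : c.Coprime N) (hc1 : c ≠ 1)
    (hQ : ∀ s' τ' h', h = h' + 1 → LoopInv N D B h' s' → τ' ≤ τ + 300 * L * B → Q s' τ') :
    vc L grow Q s τ := by
  have hN := P.le_N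
  have hB3 := P.le_B
  have hBL := P.sq_add_lt
  have hL := P.one_lt
  have hcN : c < N := hc ▸ Nat.mod_lt _ (by omega)
  -- all lower order terms are dominated by `L * B`
  have hcost : 120 * L * B + 60 * L + 10 * B + 150 ≤ 300 * L * B := by nlinarith
  obtain ⟨h', rfl⟩ : ∃ h', h = h' + 1 := by
    rcases h with _ | h'
    · have := S.lt; have := S.le; omega
    · exact ⟨h', rfl⟩
  simp only [grow, vc_block_cons, vc_mov, Nat.reduceEqDiff, if_false]
  refine vc_order (c := c) (B := B) hL (by omega) P.le_two_pow hBL hcop (by simpa using h0)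
    (by simpa using h2) (by simpa using h10) hcN (by simpa using hmem) ?_
  intro s₁ τ₁ hper hm₁ hfr₁ hτ₁
  have hfr : ∀ r < 20, s₁.reg r = s.reg r := by
    intro r hr
    rw [hfr₁ r hr]
    simp only [reg_setReg]
    rw [if_neg (by omega)]
  have e0 := (hfr 0 (by norm_num)).trans h0
  have e1 := (hfr 1 (by norm_num)).trans h1
  have e2 := (hfr 2 (by norm_num)).trans h2
  have e4 := (hfr 4 (by norm_num)).trans h4
  have e5 := (hfr 5 (by norm_num)).trans h5
  have e6 := (hfr 6 (by norm_num)).trans h6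
  have e7 := (hfr 7 (by norm_num)).trans h7
  have e10 := (hfr 10 (by norm_num)).trans h10
  simp only [vc_block_cons, vc_cond]
  constructor
  · intro hn
    refine vc_reduce P S e0 e1 e2 e4 e5 e6 e7 e10 rfl hm₁ hc hcop hc1 hper hn ?_
    intro s' τ' h'' hh hI hτ'
    exact hQ s' _ h'' hh hI (by omega)
  · intro hn
    rw [hn] at hper
    simp only [finish, vc_block_cons, vc_block_nil, vc_const, vc_mov, reg_setReg,
      Nat.reduceEqDiff, if_false, e10]
    refine ⟨by omega, by omega, by omega, ?_⟩
    refine hQ _ _ h' rfl ⟨?_, ?_, ?_, ?_, Or.inl ⟨?_, ?_, Or.inl ⟨?_, ?_⟩⟩⟩ (by omega)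
    · simp [e0]
    · simp [e1]
    · simp [e2]
    · simpa using hm₁
    · simp
    · simp
    · simp
    · simp only [reg_setReg, Nat.reduceEqDiff, if_true, if_false]
      refine correct_element_of_pow_ne_one (B := B * B) (by omega) hcN hcop
        (by have := P.lt_sq; omega) fun m h1 h2 h3 => ?_
      exact absurd (hper.2 m (by omega) h2 h3).1 (lt_irrefl 0)

end RAM

namespace RAM

/-! ### The algorithm -/

/-- One round of the main loop: if `c = a ^ M` is `1` modulo `N`, go on to `a - 1`, and otherwise
enlarge `M`. -/
def searchStep : Prog := block [mov 40 6, mov 41 4, modpow, mov 10 42, .const 13 1,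
  .arith .sub 14 42 13, .cond 14 grow (.arith .sub 6 6 13)]

/-- If `N` has a least divisor `r < N` of the form `i * M + 1` with `i ≤ B`, then `r` is the
answer, and otherwise `N` is prime. -/
def conclude : Prog := block [mov 30 0, mov 31 4, leastDivisor, .arith .sub 16 0 32,
  .cond 16 (block [.const 8 1, mov 9 32]) (.const 8 2)]

/-- The search for an element of large order, for `N > B ^ 2` without divisors up to `B + 1`. -/
def search : Prog := block [.const 4 1, .const 5 1, .const 7 0, mov 6 2, .loop 6 searchStep,
  .cond 7 .skip conclude]

theorem LoopInv.reg6_le {N D B h : ℕ} {s : State} (I : LoopInv N D B h s) : s.reg 6 ≤ B := by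
  rcases I.search with ⟨-, h, -⟩ | ⟨-, S⟩
  · omega
  · exact S.a_le

theorem vc_searchStep {L N D B h τ : ℕ} {Q : State → ℕ → Prop} {s : State}
    (P : Params L N D B) (hcop : ∀ x, 0 < x → x ≤ B → x.Coprime N) (I : LoopInv N D B h s)
    (ha : s.reg 6 ≠ 0)
    (hgrow : ∀ s' τ' h', h = h' + 1 → LoopInv N D B h' s' → τ' ≤ τ + 330 * L * B → Q s' τ')
    (hnext : ∀ s' τ', LoopInv N D B h s' → s'.reg 6 + 1 = s.reg 6 → τ' ≤ τ + 30 * L → Q s' τ') :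
    vc L searchStep Q s τ := by
  obtain ⟨h0, h1, h2, hmem, h | ⟨h7, S⟩⟩ := I
  · exact absurd h.2.1 ha
  generalize h4 : s.reg 4 = M at S
  generalize h5 : s.reg 5 = g at S
  generalize h6 : s.reg 6 = a at S ha hnext
  have hN := P.le_N
  have hB3 := P.le_B
  have hBL := P.sq_add_lt
  have hBN := P.sq_lt
  have hL := P.one_lt
  have hBB : B ≤ B * B := Nat.le_mul_self B
  have haB := S.a_le
  have hM := S.le.trans_lt (P.D_lt.trans P.N_lt)
  have hLB : L * 3 ≤ L * B := Nat.mul_le_mul_left L hB3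
  simp only [searchStep, vc_block_cons, vc_mov, reg_setReg, Nat.reduceEqDiff, if_false, h4, h6]
  refine vc_modpow hL (by omega) P.le_two_pow (by simpa using h0) (by simp; omega)
    (by simpa using hM) ?_
  intro s₁ τ₁ h42 hfr hm₁ hτ₁
  simp only [reg_setReg, Nat.reduceEqDiff, if_true, if_false] at h42
  have hfr' : ∀ r < 40, s₁.reg r = s.reg r := by
    intro r hr
    rw [hfr r hr]
    simp only [reg_setReg]
    rw [if_neg (by omega), if_neg (by omega)]
  have e0 := (hfr' 0 (by norm_num)).trans h0
  have e1 := (hfr' 1 (by norm_num)).trans h1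
  have e2 := (hfr' 2 (by norm_num)).trans h2
  have e4 := (hfr' 4 (by norm_num)).trans h4
  have e5 := (hfr' 5 (by norm_num)).trans h5
  have e6 := (hfr' 6 (by norm_num)).trans h6
  have e7 := (hfr' 7 (by norm_num)).trans h7
  have emem : ∀ i, s₁.mem i ≤ B := by rw [hm₁]; simpa using hmem
  generalize hc : a ^ M % N = c at h42
  have hacop : c.Coprime N := by
    have := (hcop a (Nat.pos_of_ne_zero ha) haB).pow_left M
    rwa [← hc, Nat.Coprime, ← Nat.gcd_rec, Nat.gcd_comm]
  have hc0 : c ≠ 0 := by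
    rintro rfl
    rw [Nat.coprime_zero_left] at hacop
    omega
  simp only [vc_block_cons, vc_arith, vc_const, vc_mov, vc_cond, Op.Fits, Op.eval, reg_setReg,
    Nat.reduceEqDiff, if_true, if_false, h42, true_and]
  refine ⟨by omega, fun hne => ?_, fun heq => ?_⟩
  · refine vc_grow P S (c := c) (by simpa using e0) (by simpa using e1) (by simpa using e2)
      (by simpa using e4) (by simpa using e5) (by simpa using e6) (by simpa using e7) (by simp)
      (by simpa using emem) hc.symm hacop (by omega) ?_
    intro s₂ τ₂ h' hh I' hτ₂
    simp only [vc_block_nil]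
    refine hgrow _ _ h' hh I' ?_
    have : 330 * L * B = 300 * L * B + 30 * (L * B) := by ring
    omega
  · simp only [vc_block_nil, e6]
    refine hnext _ _ ⟨?_, ?_, ?_, ?_, Or.inr ⟨?_, ?_⟩⟩ ?_ (by omega)
    · simp [e0]
    · simp [e1]
    · simp [e2]
    · simpa using emem
    · simp [e7]
    · simp only [reg_setReg, Nat.reduceEqDiff, if_false, if_true, e4, e5]
      refine ⟨S.pos, S.le, S.lt, S.g_lt, S.orderOf, by omega, fun x hx hxB => ?_⟩
      by_cases hxa : x = a
      · rw [hxa, hc]; omega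
      · exact S.pow_eq x (by omega) hxB
    · simp only [reg_setReg, if_true]
      omega

theorem vc_conclude {L N D B M τ : ℕ} {Q : State → ℕ → Prop} {s : State} (hL : 1 < L)
    (hN : 1 < N) (hM0 : 0 < M) (hB : B * M + 1 < 2 ^ L) (h0 : s.reg 0 = N) (h2 : s.reg 2 = B)
    (h4 : s.reg 4 = M)
    (hp : ∀ p, p.Prime → p ∣ N → ∃ k, 0 < k ∧ k ≤ B ∧ p = k * M + 1)
    (hQ : ∀ s' τ', Answered N D s' → τ' ≤ τ + 10 * B + 30 → Q s' τ') :
    vc L conclude Q s τ := by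
  have h4L : 4 ≤ 2 ^ L := (Nat.pow_le_pow_right (n := 2) (by norm_num) hL :)
  simp only [conclude, vc_block_cons, vc_mov, reg_setReg, Nat.reduceEqDiff, if_false, h0, h4]
  refine vc_leastDivisor (n := N) (M := M) (B := B) (by omega) (by simpa using h2) (by simp)
    (by simp) hB ?_
  intro s₁ τ₁ hld hfr hm₁ hτ₁
  have e0 : s₁.reg 0 = N := by rw [hfr 0 (by norm_num)]; simp [h0]
  generalize hr32 : s₁.reg 32 = r at hld
  simp only [vc_block_cons, vc_block_nil, vc_arith, vc_const, vc_mov, vc_cond, Op.Fits, Op.eval,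
    reg_setReg, Nat.reduceEqDiff, if_true, if_false, e0, hr32, true_and]
  by_cases hr : r = N
  · subst hr
    refine ⟨fun h => absurd (Nat.sub_self _) h, fun _ => ⟨by omega, hQ _ _ ?_ (by omega)⟩⟩
    exact Or.inr (Or.inr ⟨by simp, hld.prime_of_eq hN hp⟩)
  · have hf := hld.correct_factor (D := D) hM0 (by omega) hr
    refine ⟨fun h => ⟨by omega, hQ _ _ ?_ (by omega)⟩, fun h => ?_⟩
    · exact Or.inr (Or.inl ⟨by simp, by simpa using hf⟩)
    · have := hf.2.2
      omega

theorem vc_search {L N D B τ : ℕ} {Q : State → ℕ → Prop} {s : State} (P : Params L N D B)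
    (hcop : ∀ x, 0 < x → x ≤ B → x.Coprime N) (h0 : s.reg 0 = N) (h1 : s.reg 1 = D)
    (h2 : s.reg 2 = B) (hmem : ∀ i, s.mem i ≤ B)
    (hQ : ∀ s' τ', Answered N D s' → τ' ≤ τ + 500 * L ^ 2 * B → Q s' τ') :
    vc L search Q s τ := by
  have hN := P.le_N
  have hB3 := P.le_B
  have hBL := P.sq_add_lt
  have hBN := P.sq_lt
  have hL := P.one_lt
  have hLL : 2 * 2 ≤ L * L := Nat.mul_le_mul hL hL
  have hLB : L * 3 ≤ L * B := Nat.mul_le_mul_left L hB3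
  have hLLB : 2 * (L * B) ≤ L * (L * B) := Nat.mul_le_mul_right _ hL
  have hLB' : 2 * B ≤ L * B := Nat.mul_le_mul_right _ hL
  have hcost : B * (40 * L) + L * (400 * L * B) + 10 * B + 60 ≤ 500 * L ^ 2 * B := by
    have e1 : B * (40 * L) = 40 * (L * B) := by ring
    have e2 : L * (400 * L * B) = 400 * (L * (L * B)) := by ring
    have e3 : 500 * L ^ 2 * B = 500 * (L * (L * B)) := by ring
    omega
  simp only [search, vc_block_cons, vc_const, vc_mov]
  refine ⟨by omega, by omega, by omega, vc_loop (by omega) (b := B * (40 * L) + L * (400 * L * B))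
    (fun s' b => ∃ h, LoopInv N D B h s' ∧ b = s'.reg 6 * (40 * L) + h * (400 * L * B))
    ⟨L, ⟨?_, ?_, ?_, ?_, Or.inr ⟨?_, ?_⟩⟩, ?_⟩ ?_ ?_⟩
  · simp [h0]
  · simp [h1]
  · simp [h2]
  · simpa using hmem
  · simp
  · simp only [reg_setReg, Nat.reduceEqDiff, if_true, if_false, h2]
    refine ⟨one_pos, P.pos, by rw [one_mul]; exact P.D_lt.trans P.N_lt, by omega,
      fun p hp hpN => by simp, le_rfl, fun x h1 h2 => by omega⟩
  · simp [h2]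
  · rintro s' _ ⟨h, I, rfl⟩ ha
    refine vc_searchStep P hcop I ha ?_ ?_
    · rintro s'' τ' h' rfl I' hτ'
      refine ⟨_, ⟨h', I', rfl⟩, ?_⟩
      have := Nat.mul_le_mul_right (40 * L) I'.reg6_le
      have e1 : B * (40 * L) = 40 * (L * B) := by ring
      have e2 : 330 * L * B = 330 * (L * B) := by ring
      have e3 : (h' + 1) * (400 * L * B) = h' * (400 * L * B) + 400 * (L * B) := by ring
      omega
    · intro s'' τ' I' h6 hτ'
      refine ⟨_, ⟨h, I', rfl⟩, ?_⟩
      rw [← h6]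
      have : (s''.reg 6 + 1) * (40 * L) = s''.reg 6 * (40 * L) + 40 * L := by ring
      omega
  · rintro s' _ τ' ⟨h, ⟨h0, h1, h2, hmem, ⟨h7, -, hans⟩ | ⟨h7, S⟩⟩, -⟩ h6 hτ'
    · simp only [vc_block_cons, vc_block_nil, vc_cond, vc_skip, h7]
      exact ⟨fun _ => hQ _ _ hans (by omega), fun h => absurd h one_ne_zero⟩
    · simp only [vc_block_cons, vc_cond, vc_skip, h7]
      refine ⟨fun h => absurd rfl h, fun _ => ?_⟩
      rw [h6] at S
      have hM0 := S.pos
      have hMD := S.le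
      have hMB : B * s'.reg 4 ≤ B * D := Nat.mul_le_mul_left B hMD
      have hD := P.lt_sq
      refine vc_conclude (M := s'.reg 4) (D := D) hL (by omega) hM0 ?_ h0 h2 rfl ?_ ?_
      · calc B * s'.reg 4 + 1 ≤ B * (D + 1) := by rw [mul_add]; omega
          _ ≤ B * N := Nat.mul_le_mul_left B P.D_lt
          _ < N * N := Nat.mul_lt_mul_of_pos_right (by nlinarith) (by omega)
          _ ≤ 2 ^ L := P.le_two_pow
      · intro p hp hpN
        have : Fact p.Prime := ⟨hp⟩
        have hBp : B < p := by
          by_contra! hle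
          exact hp.one_lt.ne' (Nat.eq_one_of_dvd_coprimes (hcop p hp.pos hle) dvd_rfl hpN)
        refine exists_eq_mul_add_one hD hM0 hMD
          (fun x hx hxB => natCast_pow_eq_one hpN (S.pow_eq x hx hxB)) hBp ?_
        rw [← S.orderOf p hp hpN]
        refine ZMod.orderOf_dvd_card_sub_one fun h => ?_
        have := S.orderOf p hp hpN
        rw [h, orderOf_zero] at this
        omega
      · intro s'' τ'' hans hτ''
        exact hQ _ _ hans (by omega)

/-- `reg 2 := Nat.sqrt (4 * D) + 1`, the least `B` with `4 * D < B * B`. -/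
def setup : Prog := block [.const 13 1, .const 14 4, .arith .mul 14 14 1, .arith .add 14 14 13,
  .const 2 0, mov 15 14,
  .loop 15 (block [.arith .add 2 2 13, .arith .mul 16 2 2, .arith .sub 15 14 16])]

theorem vc_setup {L D τ : ℕ} {Q : State → ℕ → Prop} {s : State} (hL : 2 < L)
    (hDL : 4 * D + 1 < 2 ^ L)
    (hBL : (Nat.sqrt (4 * D) + 1) * (Nat.sqrt (4 * D) + 1) < 2 ^ L) (h1 : s.reg 1 = D)
    (hQ : ∀ s' τ', s'.reg 2 = Nat.sqrt (4 * D) + 1 → s'.reg 0 = s.reg 0 → s'.reg 1 = D →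
      s'.mem = s.mem → τ' ≤ τ + 5 * (Nat.sqrt (4 * D) + 1) + 10 → Q s' τ') :
    vc L setup Q s τ := by
  have h8 : 8 ≤ 2 ^ L := (Nat.pow_le_pow_right (n := 2) (by norm_num) hL :)
  simp only [setup, vc_block_cons, vc_const, vc_arith, vc_mov, Op.Fits, Op.eval, reg_setReg,
    Nat.reduceEqDiff, if_true, if_false, h1]
  refine ⟨by omega, by omega, by omega, Or.inr hDL, by omega, vc_loop (by omega)
    (b := 5 * (Nat.sqrt (4 * D) + 1)) (fun s' b => s'.reg 2 ≤ Nat.sqrt (4 * D) + 1 ∧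
      b = 5 * (Nat.sqrt (4 * D) + 1 - s'.reg 2) ∧ s'.reg 0 = s.reg 0 ∧ s'.reg 1 = D ∧
      s'.reg 13 = 1 ∧ s'.reg 14 = 4 * D + 1 ∧ s'.reg 15 = 4 * D + 1 - s'.reg 2 * s'.reg 2 ∧
      s'.mem = s.mem) ?_ ?_ ?_⟩
  · simp [h1]
  · rintro s' _ ⟨hle, rfl, e0, e1, e13, e14, e15, hm⟩ hne
    have hle' : s'.reg 2 ≤ Nat.sqrt (4 * D) := Nat.le_sqrt.2 (by omega)
    have hsq : (s'.reg 2 + 1) * (s'.reg 2 + 1) < 2 ^ L :=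
      (Nat.mul_le_mul (by omega) (by omega)).trans_lt hBL
    have hle1 := Nat.le_mul_self (s'.reg 2 + 1)
    simp only [vc_block_cons, vc_block_nil, vc_arith, Op.Fits, Op.eval, reg_setReg, mem_setReg,
      Nat.reduceEqDiff, if_true, if_false, e0, e1, e13, e14, true_and]
    exact ⟨by omega, hsq, _, ⟨by omega, rfl, hm⟩, by omega⟩
  · rintro s' _ τ' ⟨hle, rfl, e0, e1, e13, e14, e15, hm⟩ hz hτ
    have h2 : s'.reg 2 = Nat.sqrt (4 * D) + 1 := by
      by_contra hne
      have : s'.reg 2 * s'.reg 2 ≤ 4 * D := Nat.le_sqrt.1 (by omega)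
      omega
    simp only [vc_block_nil]
    exact hQ _ _ h2 e0 e1 hm (by omega)

/-- The algorithm: trial division up to `B + 1`, where `B` is a little larger than `2 * √D`, and
the search unless this already settles the matter. -/
def program : Prog := block [setup, mov 30 0, .const 31 1, leastDivisor, .arith .sub 16 0 32,
  .cond 16 (block [.const 8 1, mov 9 32])
    (block [.arith .mul 15 2 2, .arith .sub 16 0 15, .cond 16 search (.const 8 2)]),
  mov 0 8, mov 1 9]

theorem Answered.exists_answer {N D : ℕ} {s s' : State} (h : Answered N D s)
    (h0 : s'.reg 0 = s.reg 8) (h1 : s'.reg 1 = s.reg 9) :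
    ∃ ans : Answer, ans.ReturnedIn s' ∧ ans.Correct N D := by
  rcases h with ⟨h8, h⟩ | ⟨h8, h⟩ | ⟨h8, h⟩
  · exact ⟨.element _, ⟨h0.trans h8, h1⟩, h⟩
  · exact ⟨.factor _, ⟨h0.trans h8, h1⟩, h⟩
  · exact ⟨.prime, h0.trans h8, h⟩

theorem vc_program {L N D : ℕ} {s : State} (hL : 2 < L) (hD : 0 < D) (hDN : D < N)
    (hNL : 16 * (N * N) ≤ 2 ^ L) (h0 : s.reg 0 = N) (h1 : s.reg 1 = D) (hm : s.mem = fun _ => 0) :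
    vc L program (fun s' τ' => (∃ ans : Answer, ans.ReturnedIn s' ∧ ans.Correct N D) ∧
      τ' ≤ 600 * L ^ 2 * (Nat.sqrt (4 * D) + 1)) s 0 := by
  have h8 : 8 ≤ 2 ^ L := (Nat.pow_le_pow_right (n := 2) (by norm_num) hL :)
  have hBsq : 4 * D < (Nat.sqrt (4 * D) + 1) * (Nat.sqrt (4 * D) + 1) := Nat.lt_succ_sqrt _
  have hBD : Nat.sqrt (4 * D) < 2 * D + 1 := Nat.sqrt_lt.2 (by nlinarith)
  have hNN : 2 * N ≤ N * N := Nat.mul_le_mul_right N (by omega)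
  have hDN' : 4 * D + 1 < 2 ^ L := by omega
  obtain ⟨B, hB⟩ : ∃ B, B = Nat.sqrt (4 * D) + 1 := ⟨_, rfl⟩
  rw [← hB] at hBsq ⊢
  have hBN : B < 2 * N := by omega
  have hB0 : 0 < B := by omega
  have hBB : B * B ≤ 2 * N * (2 * N) := Nat.mul_le_mul hBN.le hBN.le
  have hBB' : 2 * N * (2 * N) = 4 * (N * N) := by ring
  have hN0 : 0 < N * N := Nat.mul_pos (by omega) (by omega)
  have hcost : 500 * L ^ 2 * B + 20 * B + 60 ≤ 600 * L ^ 2 * B := by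
    have h9 : 3 ^ 2 ≤ L ^ 2 := Nat.pow_le_pow_left hL 2
    have := Nat.mul_le_mul_right B h9
    rw [mul_assoc, mul_assoc]
    omega
  simp only [program, vc_block_cons]
  refine vc_setup hL hDN' (by rw [← hB]; omega) h1 ?_
  intro s₁ τ₁ e2 e0 e1 em hτ₁
  rw [← hB] at e2 hτ₁
  rw [h0] at e0
  simp only [vc_block_cons, vc_mov, vc_const, Nat.reduceEqDiff, if_false, e0]
  refine ⟨by omega, vc_leastDivisor (n := N) (M := 1) (B := B) (by omega) (by simpa using e2)
    (by simp) (by simp) (by omega) ?_⟩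
  intro s₂ τ₂ hld hfr hm₂ hτ₂
  have f0 : s₂.reg 0 = N := by rw [hfr 0 (by norm_num)]; simp [e0]
  have f1 : s₂.reg 1 = D := by rw [hfr 1 (by norm_num)]; simp [e1]
  have f2 : s₂.reg 2 = B := by rw [hfr 2 (by norm_num)]; simp [e2]
  have fm : s₂.mem = fun _ => 0 := by rw [hm₂, mem_setReg, mem_setReg, em, hm]
  generalize hr32 : s₂.reg 32 = r at hld
  -- copying the answer to the output registers
  have hout : ∀ s' τ', Answered N D s' → τ' + 5 ≤ 600 * L ^ 2 * B →
      vc L (mov 0 8) (vc L (mov 1 9) (vc L (block []) fun s' τ' =>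
        (∃ ans : Answer, ans.ReturnedIn s' ∧ ans.Correct N D) ∧ τ' ≤ 600 * L ^ 2 * B)) s' τ' := by
    intro s' τ' hans hτ'
    simp only [vc_mov, vc_block_nil]
    exact ⟨hans.exists_answer (by simp) (by simp), by omega⟩
  simp only [vc_block_cons, vc_block_nil, vc_arith, vc_const, vc_cond, Op.Fits, Op.eval,
    reg_setReg, Nat.reduceEqDiff, if_true, if_false, f0, f2, hr32, true_and]
  by_cases hr : r = N
  · subst hr
    refine ⟨fun h => absurd (Nat.sub_self _) h, fun _ => ⟨by omega, fun h => ?_, fun h => ?_⟩⟩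
    · have P : Params L r D B := ⟨by omega, hD, hBsq, by omega, by omega⟩
      have hB3 := P.le_B
      have hBr : B + 1 < r := by have := P.sq_lt; nlinarith
      refine vc_search P (fun x h1 h2 => hld.coprime hBr h1 h2) (by simp [f0]) (by simp [f1])
        (by simp [f2]) (by simp [fm]) ?_
      intro s₃ τ₃ hans hτ₃
      exact hout _ _ hans (by omega)
    · refine ⟨by omega, hout _ _ ?_ (by omega)⟩
      exact Or.inr (Or.inr ⟨by simp, (hld.prime_dvd (by omega) (by omega)).1⟩)
  · have hf := hld.correct_factor (D := D) one_pos (by omega) hr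
    refine ⟨fun h => ⟨by omega, ?_⟩, fun h => ?_⟩
    · simp only [vc_mov, reg_setReg, Nat.reduceEqDiff, if_false, hr32]
      exact hout _ _ (Or.inr (Or.inl ⟨by simp, by simpa using hf⟩)) (by omega)
    · have := hf.2.2
      omega

/-- The algorithm answers correctly in `O(L ^ 4 * √D)` bit operations, where `L` is of the order
of `log N`. -/
theorem exec_program {N D : ℕ} (hD : 0 < D) (hDN : D < N) :
    ∃ t s, ∃ ans : Answer, Exec program (init N D) t s ∧ ans.ReturnedIn s ∧ ans.Correct N D ∧
      t ≤ 1200 * (2 * Nat.size N + 4) ^ 4 * (Nat.sqrt (4 * D) + 1) := by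
  obtain ⟨L, hLdef⟩ : ∃ L, L = 2 * Nat.size N + 4 := ⟨_, rfl⟩
  have hsize : N < 2 ^ Nat.size N := Nat.lt_size_self N
  have hNL : 16 * (N * N) ≤ 2 ^ L := by
    calc 16 * (N * N) ≤ 16 * (2 ^ Nat.size N * 2 ^ Nat.size N) := by gcongr
      _ = 2 ^ L := by rw [hLdef, pow_add, two_mul, pow_add]; ring
  have hN : N ≤ N * N := Nat.le_mul_self N
  have hbdd : Bdd L (init N D) := by
    refine ⟨fun r => ?_, fun a => by simp [init]⟩
    simp only [init]
    split_ifs <;> omega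
  obtain ⟨t, s, k, he, ht, -, ⟨ans, hret, hcor⟩, hk⟩ := vc_sound (by omega) program
    (vc_program (L := L) (s := init N D) (by omega) hD hDN hNL rfl rfl rfl) hbdd
  refine ⟨t, s, ans, he, hret, hcor, ?_⟩
  rw [zero_add] at hk
  rw [← hLdef]
  calc t ≤ k * (2 * L ^ 2) := ht
    _ ≤ 600 * L ^ 2 * (Nat.sqrt (4 * D) + 1) * (2 * L ^ 2) := by gcongr
    _ = _ := by ring

end RAM

/-! ### The running time in terms of `D` -/

theorem tendsto_log_log_div_log :
    Filter.Tendsto (fun D : ℕ => 8 * Real.log (Real.log D + 2) / Real.log D) Filter.atTop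
      (nhds 0) := by
  have h1 : (fun y : ℝ => Real.log (y + 2)) =o[Filter.atTop] fun y : ℝ => y + 2 :=
    Real.isLittleO_log_id_atTop.comp_tendsto
      (Filter.tendsto_atTop_add_const_right _ 2 Filter.tendsto_id)
  have h2 : (fun y : ℝ => y + 2) =O[Filter.atTop] fun y : ℝ => y := by
    refine Asymptotics.IsBigO.of_bound 2 ?_
    filter_upwards [Filter.eventually_ge_atTop 2] with y hy
    rw [Real.norm_of_nonneg (by linarith), Real.norm_of_nonneg (by linarith)]
    linarith
  have h3 := ((h1.trans_isBigO h2).tendsto_div_nhds_zero.const_mul 8).comp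
    (Real.tendsto_log_atTop.comp tendsto_natCast_atTop_atTop)
  rw [mul_zero] at h3
  refine h3.congr fun D => ?_
  simp only [Function.comp_apply]
  ring

/-- The lower bound for `D` makes `log N` polynomially bounded in `log D`. -/
theorem log_le_sq_log {n d : ℝ} (hn : 0 < Real.log n)
    (h : Real.exp (Real.sqrt (2 * Real.log n * Real.log (Real.log n))) < d) :
    Real.log n ≤ Real.log d ^ 2 + 2 := by
  have hlt : Real.sqrt (2 * Real.log n * Real.log (Real.log n)) < Real.log d := by
    rw [Real.lt_log_iff_exp_lt ((Real.exp_pos _).trans h)]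
    exact h
  rcases le_or_gt (Real.log n) 2 with h2 | h2
  · nlinarith [sq_nonneg (Real.log d)]
  · have hll : 1 / 2 ≤ Real.log (Real.log n) := by
      have := Real.log_le_log (by norm_num) h2.le
      linarith [Real.log_two_gt_d9]
    have h3 := (Real.sqrt_lt' ((Real.sqrt_nonneg _).trans_lt hlt)).1 hlt
    nlinarith

theorem size_le_log {N : ℕ} (hN : 1 < N) : (Nat.size N : ℝ) ≤ 2 * Real.log N + 1 := by
  have hs : 2 ^ (Nat.size N - 1) ≤ N := by
    by_contra! h
    have h1 := Nat.size_le.2 h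
    have h2 := Nat.size_pos.2 (show 0 < N by omega)
    omega
  have h1 : ((Nat.size N - 1 : ℕ) : ℝ) * Real.log 2 ≤ Real.log N := by
    rw [← Real.log_pow]
    exact Real.log_le_log (by positivity) (by exact_mod_cast hs)
  have h2 : (Nat.size N : ℝ) ≤ ((Nat.size N - 1 : ℕ) : ℝ) + 1 := by
    norm_cast; omega
  have h3 : (0 : ℝ) ≤ ((Nat.size N - 1 : ℕ) : ℝ) := Nat.cast_nonneg _
  have h4 := Real.log_two_gt_d9
  nlinarith

theorem theorem1 :
    ∃ (P : RAM.Prog) (C : ℝ) (ε : ℕ → ℝ),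
      Filter.Tendsto ε Filter.atTop (nhds 0) ∧
      ∀ N D : ℕ, 0 < D → D < N →
        Real.exp (Real.sqrt (2 * Real.log (N : ℝ) * Real.log (Real.log (N : ℝ)))) < (D : ℝ) →
        ∃ (t : ℕ) (s : RAM.State) (ans : Answer),
          RAM.Exec P (RAM.init N D) t s ∧
          ans.ReturnedIn s ∧
          ans.Correct N D ∧
          (t : ℝ) ≤ C * (D : ℝ) ^ ((1 / 2 : ℝ) + ε D) := by
  refine ⟨RAM.program, 3600 * 14 ^ 4, fun D => 8 * Real.log (Real.log D + 2) / Real.log D,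
    tendsto_log_log_div_log, fun N D hD hDN hlarge => ?_⟩
  obtain ⟨t, s, ans, he, hret, hcor, ht⟩ := RAM.exec_program hD hDN
  refine ⟨t, s, ans, he, hret, hcor, ?_⟩
  have hD1 : (1 : ℝ) < D :=
    (Real.one_le_exp (Real.sqrt_nonneg _)).trans_lt hlarge
  have hN1 : (1 : ℝ) < N := hD1.trans (by exact_mod_cast hDN)
  have hlogD := Real.log_pos hD1
  have hlogN := log_le_sq_log (Real.log_pos hN1) hlarge
  have hsize := size_le_log (N := N) (by exact_mod_cast hN1)
  have hL : (2 * (Nat.size N : ℝ) + 4) ≤ 14 * (Real.log D + 2) ^ 2 := by nlinarith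
  have hB : ((Nat.sqrt (4 * D) : ℕ) : ℝ) + 1 ≤ 3 * Real.sqrt D := by
    have h1 : ((Nat.sqrt (4 * D) : ℕ) : ℝ) ≤ Real.sqrt ((4 * D : ℕ) : ℝ) := Real.nat_sqrt_le_real_sqrt
    have h2 : Real.sqrt ((4 * D : ℕ) : ℝ) = 2 * Real.sqrt D := by
      push_cast
      rw [Real.sqrt_mul (by norm_num), show (4 : ℝ) = 2 ^ 2 by norm_num,
        Real.sqrt_sq (by norm_num)]
    have h3 : 1 ≤ Real.sqrt D := Real.one_le_sqrt.2 hD1.le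
    linarith
  have hpow : (D : ℝ) ^ ((1 / 2 : ℝ) + 8 * Real.log (Real.log D + 2) / Real.log D) =
      Real.sqrt D * (Real.log D + 2) ^ 8 := by
    rw [Real.rpow_add (by linarith), ← Real.sqrt_eq_rpow, Real.rpow_def_of_pos (by linarith)]
    congr 1
    rw [mul_div_cancel₀ _ hlogD.ne', mul_comm, Real.exp_mul, Real.exp_log (by linarith)]
    norm_cast
  rw [hpow]
  calc (t : ℝ) ≤ 1200 * (2 * (Nat.size N : ℝ) + 4) ^ 4 * (((Nat.sqrt (4 * D) : ℕ) : ℝ) + 1) := by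
        exact_mod_cast ht
    _ ≤ 1200 * (14 * (Real.log D + 2) ^ 2) ^ 4 * (3 * Real.sqrt D) := by gcongr
    _ = _ := by ring
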